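/- Let $r>0$. Let $\mathcal{WL}_r$ be the set of pairs $(W,f)$ with $W:[0,1]^2\to[0,1]$ measurable and symmetric and $f:[0,1]\to[-r,r]$ measurable. Put $\|W\|_\square=\sup_{S,T}|\int_{S\times T}W|$ and $\|f\|_\square=\sup_S|\int_S f|$, with suprema over measurable $S,T\subseteq[0,1]$, and $$\delta_\square\big((W,f),(V,g)\big)=\inf_{\phi}\big(\|W-V^\phi\|_\square+\|f-g^\phi\|_\square\big),\qquad V^\phi(x,y)=V(\phi(x),\phi(y)),\quad g^\phi=g\circ\phi,$$ where $\phi$ ranges over the measure preserving measurable bijections between co-null subsets of $[0,1]$. Let $\widetilde{\mathcal{WL}_r}$ be the metric space obtained from $\mathcal{WL}_r$ by identifying points at $\delta_\square$-distance $0$, with its Borel $\sigma$-algebra. All spaces $\mathbb R^m$ carry the norm $\|\cdot\|_\infty$. Let $a>2$ and $k(\epsilon)=\lceil 2^{a/\epsilon^2}\rceil$. There is $\epsilon_0>0$, depending only on $r$ and $a$, such that $\widetilde{\mathcal{WL}_r}$ is covered by $2^{k(\epsilon)^2}$ balls of radius $\epsilon$ for every $0<\epsilon\le\epsilon_0$,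 and such that the following holds. Let $C\ge 1$, $N\ge1$, $L_1>0$, $L_2\ge 0$, $p>0$, and $L=L_1L_2$. Let $\nu$ be any Borel probability measure on $\widetilde{\mathcal{WL}_r}$. Let $\mathcal C:\widetilde{\mathcal{WL}_r}\to\{0,1\}^C$ be a classifier: there is a partition of $\widetilde{\mathcal{WL}_r}$ into Borel sets $B_1,\dots,B_C$ such that $\mathcal C$ equals the $i$-th standard basis vector $e_i$ on $B_i$. Put $\epsilon_1=\epsilon_0\min\{1,L_1\}$; let $\kappa(\epsilon)=2^{k(\epsilon)^2}$ for $0<\epsilon\le\epsilon_1$ and $\kappa(\epsilon)=\kappa(\epsilon_1)$ for $\epsilon>\epsilon_1$; let $\xi(\epsilon)=\kappa(\epsilon)^2\log\kappa(\epsilon)/\epsilon^2$, a strictly decreasing function on $(0,\infty)$, and let $\xi^{-1}(y)=\inf\{\epsilon>0:\xi(\epsilon)\le y\}$ be its (generalized) inverse. Then there is a measurable event $\mathcal U^p\subseteq\widetilde{\mathcal{WL}_r}^N$ with $$\nu^N(\mathcal U^p)\ \ge\ 1-Cp-\frac{2C^2}{N}$$ such that for every $\mathbf X=(X_1,\dots,X_N)\in\mathcal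 U^p$, every $L_2$-Lipschitz loss $\mathcal E:\mathbb R^C\times\mathbb R^C\to\mathbb R$ and every $L_1$-Lipschitz $\Upsilon:\widetilde{\mathcal{WL}_r}\to\mathbb R^C$ (both may depend on $\mathbf X$), $$\Big|\int\mathcal E(\Upsilon(x),\mathcal C(x))\,d\nu(x)-\frac1N\sum_{i=1}^N\mathcal E(\Upsilon(X_i),\mathcal C(X_i))\Big|\le \xi^{-1}\!\Big(\frac{N}{2C}\Big)\Big(2L+\frac1{\sqrt2}\big(L+|\mathcal E(0,0)|\big)\big(1+\sqrt{\log(2/p)}\big)\Big),$$ where $\sqrt{\log(2/p)}$ is read as $0$ if $p>2$ (in which case the probability bound is trivial). -/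

import Mathlib

namespace GraphonSignals

noncomputable section

open MeasureTheory Set
open scoped unitInterval NNReal

/-! ### Graphon-signals and cut norms -/

/-- A graphon-signal: a graphon `W`, i.e. a symmetric measurable kernel `[0,1]² → [0,1]`, together
with a measurable signal `f : [0,1] → [-r, r]`. -/
structure GraphonSignal (r : ℝ) where
  W : I → I → ℝ
  f : I → ℝ
  measurable_W : Measurable (fun z : I × I => W z.1 z.2)
  symm_W : ∀ x y, W x y = W y x
  W_mem : ∀ x y, W x y ∈ Icc (0 : ℝ) 1
  measurable_f : Measurable f
  abs_f_le : ∀ x, |f x| ≤ r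

/-- The cut norm of a kernel: the supremum of `|∫_{S × T} W|` over measurable `S, T ⊆ [0,1]`. -/
def kernelCutNorm (W : I → I → ℝ) : ℝ :=
  ⨆ P : {S : Set I // MeasurableSet S} × {T : Set I // MeasurableSet T},
    |∫ z in (P.1 : Set I) ×ˢ (P.2 : Set I), W z.1 z.2|

/-- The cut norm of a signal: the supremum of `|∫_S f|` over measurable `S ⊆ [0,1]`. -/
def signalCutNorm (f : I → ℝ) : ℝ :=
  ⨆ S : {S : Set I // MeasurableSet S}, |∫ x in (S : Set I), f x|

/-- Measurable measure preserving bijections `dom → cod` between co-null subsets of `[0,1]`. The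
map is extended measurably to all of `[0,1]`; its values off `dom` (a null set) are irrelevant. -/
structure ConullBijection where
  toFun : I → I
  dom : Set I
  cod : Set I
  measurable_toFun : Measurable toFun
  measurableSet_dom : MeasurableSet dom
  measurableSet_cod : MeasurableSet cod
  conull_dom : volume domᶜ = 0
  conull_cod : volume codᶜ = 0
  bijOn : BijOn toFun dom cod
  measure_image : ∀ S ⊆ dom, MeasurableSet S → volume (toFun '' S) = volume S

/-- The graphon-signal cut metric `d_□((W, f), (V, g)) = ‖W - V‖_□ + ‖f - g‖_□`. -/
def cutMetric (W : I → I → ℝ) (f : I → ℝ) (V : I → I → ℝ) (g : I → ℝ) : ℝ :=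
  kernelCutNorm (fun x y => W x y - V x y) + signalCutNorm (fun x => f x - g x)

/-- The graphon-signal cut distance `δ_□((W, f), (V, g)) = inf_φ d_□((W, f), (V, g)^φ)`. -/
def cutDist {r : ℝ} (u v : GraphonSignal r) : ℝ :=
  ⨅ φ : ConullBijection,
    cutMetric u.W u.f (fun x y => v.W (φ.toFun x) (φ.toFun y)) (fun x => v.f (φ.toFun x))

/-! ### The cut distance is a pseudometric -/

section Aux

variable {Ω ι : Type*} [MeasurableSpace Ω]

/-- Supremum of `|∫_S F|` over an indexed family of sets. -/
def supInt (μ : Measure Ω) (s : ι → Set Ω) (F : Ω → ℝ) : ℝ :=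
  ⨆ i, |∫ z in s i, F z ∂μ|

/-- Bounded measurable functions. -/
def BM (F : Ω → ℝ) : Prop := Measurable F ∧ ∃ M, ∀ z, |F z| ≤ M

lemma BM.integrable {F : Ω → ℝ} (h : BM F) (μ : Measure Ω) [IsFiniteMeasure μ] :
    Integrable F μ := by
  obtain ⟨hm, M, hM⟩ := h
  exact Integrable.of_bound hm.aestronglyMeasurable M (Filter.Eventually.of_forall hM)

lemma BM.sub {F G : Ω → ℝ} (hF : BM F) (hG : BM G) : BM (fun z => F z - G z) := by
  obtain ⟨hm, M, hM⟩ := hF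
  obtain ⟨hm', M', hM'⟩ := hG
  exact ⟨hm.sub hm', M + M', fun z => (abs_sub _ _).trans (add_le_add (hM z) (hM' z))⟩

lemma BM.comp {Ω' : Type*} [MeasurableSpace Ω'] {F : Ω → ℝ} (hF : BM F) {g : Ω' → Ω}
    (hg : Measurable g) : BM (fun z => F (g z)) :=
  ⟨hF.1.comp hg, hF.2.imp fun _ h z => h (g z)⟩

lemma supInt_nonneg (μ : Measure Ω) (s : ι → Set Ω) (F : Ω → ℝ) : 0 ≤ supInt μ s F :=
  Real.iSup_nonneg fun _ => abs_nonneg _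

lemma bdd_supInt (μ : Measure Ω) [IsFiniteMeasure μ] (s : ι → Set Ω) {F : Ω → ℝ}
    (hF : BM F) : BddAbove (range fun i => |∫ z in s i, F z ∂μ|) := by
  refine ⟨∫ z, |F z| ∂μ, ?_⟩
  rintro _ ⟨i, rfl⟩
  refine (abs_integral_le_integral_abs).trans ?_
  exact setIntegral_le_integral (hF.integrable μ).abs (Filter.Eventually.of_forall fun _ => abs_nonneg _)

lemma supInt_add_le (μ : Measure Ω) [IsFiniteMeasure μ] (s : ι → Set Ω) {F G H : Ω → ℝ}
    (hF : BM F) (hG : BM G) (h : ∀ z, H z = F z + G z) :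
    supInt μ s H ≤ supInt μ s F + supInt μ s G := by
  refine Real.iSup_le (fun i => ?_) (add_nonneg (supInt_nonneg _ _ _) (supInt_nonneg _ _ _))
  have : ∫ z in s i, H z ∂μ = ∫ z in s i, F z ∂μ + ∫ z in s i, G z ∂μ := by
    rw [← integral_add (hF.integrable _) (hG.integrable _)]
    simp only [h]
  rw [this]
  exact (abs_add_le _ _).trans
    (add_le_add (le_ciSup (bdd_supInt μ s hF) i) (le_ciSup (bdd_supInt μ s hG) i))

lemma supInt_neg (μ : Measure Ω) (s : ι → Set Ω) {F G : Ω → ℝ} (h : ∀ z, G z = - F z) :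
    supInt μ s G = supInt μ s F := by
  unfold supInt
  simp only [h, integral_neg, abs_neg]

lemma supInt_congr {μ : Measure Ω} (s : ι → Set Ω) {F G : Ω → ℝ} (h : F =ᵐ[μ] G) :
    supInt μ s F = supInt μ s G := by
  unfold supInt
  congr 1
  funext i
  rw [integral_congr_ae (ae_restrict_of_ae h)]

lemma supInt_comp_le {μ : Measure Ω} [IsFiniteMeasure μ] (s : ι → Set Ω) {F : Ω → ℝ}
    (hF : BM F) {g : Ω → Ω} (hg : MeasurePreserving g μ μ)
    (hs : ∀ i, ∃ j, MeasurableSet (s j) ∧ s i =ᵐ[μ] g ⁻¹' (s j)) :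
    supInt μ s (fun z => F (g z)) ≤ supInt μ s F := by
  refine Real.iSup_le (fun i => ?_) (supInt_nonneg _ _ _)
  obtain ⟨j, hj, hij⟩ := hs i
  have : ∫ z in s i, F (g z) ∂μ = ∫ z in s j, F z ∂μ := by
    rw [setIntegral_congr_set hij]
    conv_rhs => rw [← hg.map_eq]
    rw [setIntegral_map hj hF.1.aestronglyMeasurable hg.measurable.aemeasurable]
  rw [this]
  exact le_ciSup (bdd_supInt μ s hF) j

end Aux

namespace ConullBijection

lemma ae_dom (φ : ConullBijection) : ∀ᵐ x, x ∈ φ.dom := φ.conull_dom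

lemma ae_cod (φ : ConullBijection) : ∀ᵐ x, x ∈ φ.cod := φ.conull_cod

lemma measurePreserving (φ : ConullBijection) :
    MeasurePreserving φ.toFun volume volume := by
  refine ⟨φ.measurable_toFun, ?_⟩
  ext S hS
  rw [Measure.map_apply φ.measurable_toFun hS]
  have h1 : volume (φ.toFun ⁻¹' S) = volume (φ.toFun ⁻¹' S ∩ φ.dom) := by
    refine measure_congr ?_
    filter_upwards [φ.ae_dom] with x hx
    exact propext ⟨fun h => ⟨h, hx⟩, fun h => h.1⟩
  have h2 : volume S = volume (S ∩ φ.cod) := by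
    refine measure_congr ?_
    filter_upwards [φ.ae_cod] with x hx
    exact propext ⟨fun h => ⟨h, hx⟩, fun h => h.1⟩
  rw [h1, h2, ← φ.measure_image _ inter_subset_right
    ((φ.measurable_toFun hS).inter φ.measurableSet_dom)]
  congr 1
  ext y
  constructor
  · rintro ⟨x, ⟨hx, hxd⟩, rfl⟩
    exact ⟨hx, φ.bijOn.mapsTo hxd⟩
  · rintro ⟨hy, hyc⟩
    obtain ⟨x, hxd, rfl⟩ := φ.bijOn.surjOn hyc
    exact ⟨x, ⟨hy, hxd⟩, rfl⟩

lemma measurableSet_image (φ : ConullBijection) {S : Set I} (hS : MeasurableSet S) :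
    MeasurableSet (φ.toFun '' (S ∩ φ.dom)) :=
  (hS.inter φ.measurableSet_dom).image_of_measurable_injOn φ.measurable_toFun
    (φ.bijOn.injOn.mono inter_subset_right)

lemma ae_eq_preimage (φ : ConullBijection) (S : Set I) :
    S =ᵐ[volume] φ.toFun ⁻¹' (φ.toFun '' (S ∩ φ.dom)) := by
  filter_upwards [φ.ae_dom] with x hx
  refine propext ⟨fun h => ⟨x, ⟨h, hx⟩, rfl⟩, ?_⟩
  rintro ⟨y, ⟨hy, hyd⟩, hxy⟩
  rwa [φ.bijOn.injOn hyd hx hxy] at hy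

/-- The identity. -/
protected def refl : ConullBijection where
  toFun := id
  dom := univ
  cod := univ
  measurable_toFun := measurable_id
  measurableSet_dom := .univ
  measurableSet_cod := .univ
  conull_dom := by simp
  conull_cod := by simp
  bijOn := bijOn_id _
  measure_image := by simp

/-- Composition. -/
protected def trans (φ ψ : ConullBijection) : ConullBijection where
  toFun := fun x => ψ.toFun (φ.toFun x)
  dom := φ.dom ∩ φ.toFun ⁻¹' ψ.dom
  cod := ψ.toFun '' (φ.cod ∩ ψ.dom)
  measurable_toFun := ψ.measurable_toFun.comp φ.measurable_toFun
  measurableSet_dom := φ.measurableSet_dom.inter (φ.measurable_toFun ψ.measurableSet_dom)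
  measurableSet_cod := ψ.measurableSet_image φ.measurableSet_cod
  conull_dom := by
    have h : ∀ᵐ x, φ.toFun x ∈ ψ.dom :=
      φ.measurePreserving.quasiMeasurePreserving.ae ψ.ae_dom
    have : ∀ᵐ x, x ∈ φ.dom ∩ φ.toFun ⁻¹' ψ.dom := by
      filter_upwards [φ.ae_dom, h] with x h1 h2 using ⟨h1, h2⟩
    exact this
  conull_cod := by
    rw [prob_compl_eq_zero_iff (ψ.measurableSet_image φ.measurableSet_cod),
      ψ.measure_image _ inter_subset_right (φ.measurableSet_cod.inter ψ.measurableSet_dom),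
      ← prob_compl_eq_zero_iff (φ.measurableSet_cod.inter ψ.measurableSet_dom)]
    have : ∀ᵐ x, x ∈ φ.cod ∩ ψ.dom := by
      filter_upwards [φ.ae_cod, ψ.ae_dom] with x h1 h2 using ⟨h1, h2⟩
    exact this
  bijOn := by
    refine ⟨fun x hx => ⟨φ.toFun x, ⟨φ.bijOn.mapsTo hx.1, hx.2⟩, rfl⟩, ?_, ?_⟩
    · intro x hx y hy hxy
      exact φ.bijOn.injOn hx.1 hy.1 (ψ.bijOn.injOn hx.2 hy.2 hxy)
    · rintro _ ⟨y, ⟨hy, hyd⟩, rfl⟩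
      obtain ⟨x, hx, rfl⟩ := φ.bijOn.surjOn hy
      exact ⟨x, ⟨hx, hyd⟩, rfl⟩
  measure_image := by
    intro S hS hSm
    have hSφ : S ⊆ φ.dom := fun x hx => (hS hx).1
    have e : φ.toFun '' S = φ.toFun '' (S ∩ φ.dom) := by rw [inter_eq_left.2 hSφ]
    have : (fun x => ψ.toFun (φ.toFun x)) '' S = ψ.toFun '' (φ.toFun '' S) := by
      rw [image_image]
    rw [this, ψ.measure_image, φ.measure_image S hSφ hSm]
    · rintro _ ⟨x, hx, rfl⟩
      exact (hS hx).2
    · rw [e]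
      exact φ.measurableSet_image hSm

open Classical in
/-- The inverse on `cod`, extended by `0`. -/
def invFun (φ : ConullBijection) (y : I) : I :=
  if y ∈ φ.cod then Function.invFunOn φ.toFun φ.dom y else 0

lemma invFun_mem (φ : ConullBijection) {y : I} (hy : y ∈ φ.cod) : φ.invFun y ∈ φ.dom := by
  rw [invFun, if_pos hy]
  exact Function.invFunOn_mem (φ.bijOn.surjOn hy)

lemma apply_invFun (φ : ConullBijection) {y : I} (hy : y ∈ φ.cod) :
    φ.toFun (φ.invFun y) = y := by
  rw [invFun, if_pos hy]
  exact Function.invFunOn_eq (φ.bijOn.surjOn hy)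

lemma invFun_apply (φ : ConullBijection) {x : I} (hx : x ∈ φ.dom) :
    φ.invFun (φ.toFun x) = x :=
  φ.bijOn.injOn (φ.invFun_mem (φ.bijOn.mapsTo hx)) hx (φ.apply_invFun (φ.bijOn.mapsTo hx))

/-- The inverse. -/
protected def symm (φ : ConullBijection) : ConullBijection where
  toFun := φ.invFun
  dom := φ.cod
  cod := φ.dom
  measurable_toFun := by
    intro S hS
    have : φ.invFun ⁻¹' S =
        φ.toFun '' (S ∩ φ.dom) ∪ (φ.codᶜ ∩ {_y | (0 : I) ∈ S}) := by
      ext y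
      by_cases hy : y ∈ φ.cod
      · constructor
        · intro h
          exact Or.inl ⟨φ.invFun y, ⟨h, φ.invFun_mem hy⟩, φ.apply_invFun hy⟩
        · rintro (⟨x, ⟨hx, hxd⟩, rfl⟩ | h)
          · rw [mem_preimage, φ.invFun_apply hxd]
            exact hx
          · exact absurd hy h.1
      · have h0 : φ.invFun y = 0 := by rw [invFun, if_neg hy]
        constructor
        · intro h
          rw [mem_preimage, h0] at h
          exact Or.inr ⟨hy, h⟩
        · rintro (⟨x, ⟨hx, hxd⟩, rfl⟩ | h)
          · exact absurd (φ.bijOn.mapsTo hxd) hy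
          · rw [mem_preimage, h0]
            exact h.2
    rw [this]
    exact (φ.measurableSet_image hS).union (φ.measurableSet_cod.compl.inter (.const _))
  measurableSet_dom := φ.measurableSet_cod
  measurableSet_cod := φ.measurableSet_dom
  conull_dom := φ.conull_cod
  conull_cod := φ.conull_dom
  bijOn := by
    refine ⟨fun y hy => φ.invFun_mem hy, ?_, ?_⟩
    · intro y hy z hz h
      rw [← φ.apply_invFun hy, h, φ.apply_invFun hz]
    · intro x hx
      exact ⟨φ.toFun x, φ.bijOn.mapsTo hx, φ.invFun_apply hx⟩
  measure_image := by
    intro S hS hSm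
    have h1 : φ.invFun '' S = φ.toFun ⁻¹' S ∩ φ.dom := by
      ext x
      constructor
      · rintro ⟨y, hy, rfl⟩
        refine ⟨?_, φ.invFun_mem (hS hy)⟩
        rw [mem_preimage, φ.apply_invFun (hS hy)]
        exact hy
      · rintro ⟨hx, hxd⟩
        exact ⟨φ.toFun x, hx, φ.invFun_apply hxd⟩
    have h2 : φ.toFun '' (φ.toFun ⁻¹' S ∩ φ.dom) = S := by
      rw [← h1, image_image]
      ext y
      constructor
      · rintro ⟨z, hz, rfl⟩
        change φ.toFun (φ.invFun z) ∈ S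
        rw [φ.apply_invFun (hS hz)]
        exact hz
      · intro hy
        exact ⟨y, hy, φ.apply_invFun (hS hy)⟩
    rw [h1, ← φ.measure_image _ inter_subset_right
      ((φ.measurable_toFun hSm).inter φ.measurableSet_dom), h2]

lemma prodMP (φ : ConullBijection) :
    MeasurePreserving (fun z : I × I => (φ.toFun z.1, φ.toFun z.2)) volume volume :=
  φ.measurePreserving.prod φ.measurePreserving

end ConullBijection

instance : Nonempty ConullBijection := ⟨ConullBijection.refl⟩

/-- The rectangle `S × T`. -/
abbrev rect (P : {S : Set I // MeasurableSet S} × {T : Set I // MeasurableSet T}) :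
    Set (I × I) := (P.1 : Set I) ×ˢ (P.2 : Set I)

lemma kernel_eq (W : I → I → ℝ) :
    kernelCutNorm W = supInt volume rect (fun z : I × I => W z.1 z.2) := rfl

lemma signal_eq (f : I → ℝ) :
    signalCutNorm f = supInt volume (fun S : {S : Set I // MeasurableSet S} => (S : Set I)) f := rfl

lemma GraphonSignal.bmW {r : ℝ} (u : GraphonSignal r) :
    BM (fun z : I × I => u.W z.1 z.2) :=
  ⟨u.measurable_W, 1, fun z => by
    rw [abs_of_nonneg (u.W_mem _ _).1]; exact (u.W_mem _ _).2⟩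

lemma GraphonSignal.bmf {r : ℝ} (u : GraphonSignal r) : BM u.f :=
  ⟨u.measurable_f, r, u.abs_f_le⟩

lemma kernel_comp_le (φ : ConullBijection) {F : I × I → ℝ} (hF : BM F) :
    supInt volume rect (fun z : I × I => F (φ.toFun z.1, φ.toFun z.2)) ≤
      supInt volume rect F := by
  refine supInt_comp_le rect hF φ.prodMP ?_
  rintro ⟨⟨S, hS⟩, ⟨T, hT⟩⟩
  refine ⟨(⟨_, φ.measurableSet_image hS⟩, ⟨_, φ.measurableSet_image hT⟩),
    (φ.measurableSet_image hS).prod (φ.measurableSet_image hT), ?_⟩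
  have := Measure.set_prod_ae_eq (φ.ae_eq_preimage S) (φ.ae_eq_preimage T)
  exact this

lemma signal_comp_le (φ : ConullBijection) {F : I → ℝ} (hF : BM F) :
    supInt volume (fun S : {S : Set I // MeasurableSet S} => (S : Set I))
        (fun z => F (φ.toFun z)) ≤
      supInt volume (fun S : {S : Set I // MeasurableSet S} => (S : Set I)) F := by
  refine supInt_comp_le _ hF φ.measurePreserving ?_
  rintro ⟨S, hS⟩
  exact ⟨⟨_, φ.measurableSet_image hS⟩, φ.measurableSet_image hS, φ.ae_eq_preimage S⟩

lemma cutMetric_nonneg (W : I → I → ℝ) (f : I → ℝ) (V : I → I → ℝ) (g : I → ℝ) :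
    0 ≤ cutMetric W f V g :=
  add_nonneg (supInt_nonneg _ _ _) (supInt_nonneg _ _ _)

lemma cutDist_le {r : ℝ} (u v : GraphonSignal r) (φ : ConullBijection) :
    cutDist u v ≤
      cutMetric u.W u.f (fun x y => v.W (φ.toFun x) (φ.toFun y)) (fun x => v.f (φ.toFun x)) :=
  ciInf_le ⟨0, by rintro _ ⟨φ, rfl⟩; exact cutMetric_nonneg _ _ _ _⟩ φ

lemma cutDist_self {r : ℝ} (u : GraphonSignal r) : cutDist u u = 0 := by
  refine le_antisymm ((cutDist_le u u ConullBijection.refl).trans ?_)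
    (Real.iInf_nonneg fun φ => cutMetric_nonneg _ _ _ _)
  simp [cutMetric, kernelCutNorm, signalCutNorm, ConullBijection.refl]

lemma cutDist_symm_le {r : ℝ} (u v : GraphonSignal r) : cutDist u v ≤ cutDist v u := by
  refine le_ciInf fun φ => (cutDist_le u v φ.symm).trans ?_
  have hinv : ∀ᵐ x : I, φ.toFun (φ.symm.toFun x) = x := by
    filter_upwards [φ.ae_cod] with x hx using φ.apply_invFun hx
  unfold cutMetric
  simp only [kernel_eq, signal_eq]
  refine add_le_add ?_ ?_
  · have h1 : BM (fun z : I × I => u.W (φ.toFun z.1) (φ.toFun z.2) - v.W z.1 z.2) :=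
      (u.bmW.comp φ.prodMP.measurable).sub v.bmW
    have h2 := kernel_comp_le φ.symm h1
    rw [← supInt_neg volume rect (F := fun z : I × I => v.W z.1 z.2 - u.W (φ.toFun z.1) (φ.toFun z.2))
      (G := fun z : I × I => u.W (φ.toFun z.1) (φ.toFun z.2) - v.W z.1 z.2) (fun z => by ring)]
    refine le_trans (le_of_eq (supInt_congr rect ?_)) h2
    have e1 : ∀ᵐ z : I × I, φ.toFun (φ.symm.toFun z.1) = z.1 :=
      Measure.quasiMeasurePreserving_fst.ae hinv
    have e2 : ∀ᵐ z : I × I, φ.toFun (φ.symm.toFun z.2) = z.2 :=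
      Measure.quasiMeasurePreserving_snd.ae hinv
    filter_upwards [e1, e2] with z h1 h2
    rw [h1, h2]
  · have h1 : BM (fun z : I => u.f (φ.toFun z) - v.f z) :=
      (u.bmf.comp φ.measurable_toFun).sub v.bmf
    have h2 := signal_comp_le φ.symm h1
    rw [← supInt_neg volume (fun S : {S : Set I // MeasurableSet S} => (S : Set I))
      (F := fun z : I => v.f z - u.f (φ.toFun z))
      (G := fun z : I => u.f (φ.toFun z) - v.f z) (fun z => by ring)]
    refine le_trans (le_of_eq (supInt_congr _ ?_)) h2
    filter_upwards [hinv] with z h1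
    rw [h1]

lemma cutDist_comm {r : ℝ} (u v : GraphonSignal r) : cutDist u v = cutDist v u :=
  le_antisymm (cutDist_symm_le u v) (cutDist_symm_le v u)

lemma cutDist_triangle {r : ℝ} (u v w : GraphonSignal r) :
    cutDist u w ≤ cutDist u v + cutDist v w := by
  refine le_ciInf_add_ciInf fun φ ψ => (cutDist_le u w (φ.trans ψ)).trans ?_
  unfold cutMetric
  simp only [kernel_eq, signal_eq]
  rw [add_add_add_comm]
  refine add_le_add ?_ ?_
  · have hv := v.bmW.comp φ.prodMP.measurable
    have hw := w.bmW.comp ψ.prodMP.measurable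
    refine (supInt_add_le volume rect (u.bmW.sub hv)
      ((v.bmW.sub hw).comp φ.prodMP.measurable) (fun z => ?_)).trans
      (add_le_add le_rfl (kernel_comp_le φ (v.bmW.sub hw)))
    simp [ConullBijection.trans]
  · have hv := v.bmf.comp φ.measurable_toFun
    have hw := w.bmf.comp ψ.measurable_toFun
    refine (supInt_add_le volume _ (u.bmf.sub hv)
      ((v.bmf.sub hw).comp φ.measurable_toFun) (fun z => ?_)).trans
      (add_le_add le_rfl (signal_comp_le φ (v.bmf.sub hw)))
    simp [ConullBijection.trans]

instance instPseudoMetricSpace (r : ℝ) : PseudoMetricSpace (GraphonSignal r) where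
  dist := cutDist
  dist_self := cutDist_self
  dist_comm := cutDist_comm
  dist_triangle := cutDist_triangle

/-! ### The graphon-signal space -/

/-- The graphon-signal space: graphon-signals modulo `δ_□ = 0`, with the induced metric `δ_□`. -/
abbrev GraphonSignalSpace (r : ℝ) : Type := SeparationQuotient (GraphonSignal r)

instance instMeasurableSpace (r : ℝ) : MeasurableSpace (GraphonSignalSpace r) := borel _

instance instBorelSpace (r : ℝ) : BorelSpace (GraphonSignalSpace r) := ⟨rfl⟩

/-! ### Covering numbers and the rate -/

/-- The explicit covering number `2 ^ k²` with `k = ⌈2 ^ (a / ε²)⌉`. -/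
def coverFormula (a ε : ℝ) : ℕ := 2 ^ (⌈(2 : ℝ) ^ (a / ε ^ 2)⌉₊ ^ 2)

/-- The covering function `κ` on `(0, ∞)`: it is the explicit formula for `ε ≤ ε₁`, where the
formula is valid, and is continued by its value at `ε₁` for `ε > ε₁`. -/
def kappa (a ε₁ ε : ℝ) : ℕ := coverFormula a (min ε ε₁)

/-- `ξ(ε) = κ(ε)² log κ(ε) / ε²`. -/
def xi (a ε₁ ε : ℝ) : ℝ := (kappa a ε₁ ε : ℝ) ^ 2 * Real.log (kappa a ε₁ ε) / ε ^ 2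

/-- The inverse of `ξ`. As `ξ` is strictly decreasing on `(0, ∞)` but jumps (because of the ceiling),
this is the generalized inverse: the least `ε > 0` with `ξ(ε) ≤ y`. It satisfies
`xiInv (ξ ε) = ε` for all `ε > 0`. -/
def xiInv (a ε₁ y : ℝ) : ℝ := sInf {ε : ℝ | 0 < ε ∧ xi a ε₁ ε ≤ y}

/-! ### The classification setting -/

/-- A ground truth classifier into `C` classes: the space is partitioned into Borel sets
`B 1, …, B C`, and the classifier is the standard basis vector `e i` on `B i`. -/
def IsClassifier {r : ℝ} {C : ℕ} (cl : GraphonSignalSpace r → Fin C → ℝ) : Prop :=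
  ∃ B : Fin C → Set (GraphonSignalSpace r),
    (∀ i, MeasurableSet (B i)) ∧ (∀ i j, i ≠ j → Disjoint (B i) (B j)) ∧ (⋃ i, B i) = univ ∧
      ∀ i, ∀ x ∈ B i, cl x = Pi.single i 1

/-- The statistical risk. -/
def statRisk {r : ℝ} {C : ℕ} (ν : Measure (GraphonSignalSpace r))
    (loss : (Fin C → ℝ) × (Fin C → ℝ) → ℝ) (cl Υ : GraphonSignalSpace r → Fin C → ℝ) : ℝ :=
  ∫ x, loss (Υ x, cl x) ∂ν

/-- The empirical risk on the samples `X 1, …, X N`. -/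
def empRisk {r : ℝ} {C N : ℕ}
    (loss : (Fin C → ℝ) × (Fin C → ℝ) → ℝ) (cl Υ : GraphonSignalSpace r → Fin C → ℝ)
    (X : Fin N → GraphonSignalSpace r) : ℝ :=
  (1 / (N : ℝ)) * ∑ i, loss (Υ (X i), cl (X i))

end

end GraphonSignals

/-! The proof reduces a continuum of models and losses to finitely many frequencies. Cover the space
by `κ` balls of radius `e` and record, for each point, a ball containing it and its class. This
statistic takes at most `κ * C` values. An `L`-Lipschitz dependence on the point costs at most `L *
e` when the point is moved to its ball centre with the class kept fixed, so up to `2 * L * e` both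
risks depend only on cell frequencies. By Hoeffding and a union bound over all `2 ^ (κ * C)` sets of
cells, the empirical cell distribution is within `2 * t` of the true one in `ℓ¹`, with probability
at least `1 - p`. This single event serves all losses and models at once, and is already more likely
than required (`exists_event_forall_step`, `exists_event_generalization`).

The covering number comes from weak regularity: about `1 / ε ^ 2` energy decrements give a partition
into `4 ^ m` parts with `m` near `1 / ε ^ 2`. Sorting the parts into intervals by a measure
preserving map and rounding all values leaves finitely many codes. The dominant cost is a value for
each of the `16 ^ m` pairs of parts, and `16 ^ m` times a polynomial in `m` is eventually below `k ^
2`, of size at least `4 ^ (a / ε ^ 2)`, because `a > 2` (`exists_cover`).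

The sample size condition encoded in `xiInv` makes `t` of order `ε / √κ`. Since `κ` is enormous, `√κ
≥ 8 / e` absorbs the oscillation of the loss and leaves the stated constants (`two_mul_sqrt_le`,
`error_le_rate`). -/

namespace GraphonSignals

noncomputable section

open MeasureTheory Set
open scoped unitInterval NNReal

/-! ### Concentration of the empirical distribution of a discrete statistic. -/

section Statistics

variable {Ω : Type*} [MeasurableSpace Ω]

/-- Hoeffding's inequality for the empirical frequency of an event. -/
lemma measureReal_pi_frequency_ge_le (ν : Measure Ω) [IsProbabilityMeasure ν] {N : ℕ} (hN : 1 ≤ N)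
    {A : Set Ω} (hA : MeasurableSet A) {t : ℝ} (ht : 0 ≤ t) :
    (Measure.pi fun _ : Fin N => ν).real
      {X | N * t ≤ ∑ i, (A.indicator (fun _ => (1 : ℝ)) (X i) - ν.real A)} ≤
      Real.exp (-(2 * N * t ^ 2)) := by
  have hmeas : Measurable (A.indicator fun _ => (1 : ℝ)) := measurable_const.indicator hA
  have hsub : ProbabilityTheory.HasSubgaussianMGF
      (fun x => A.indicator (fun _ => (1 : ℝ)) x - ν.real A) ((‖(1 : ℝ) - 0‖₊ / 2) ^ 2) ν := by
    have h := ProbabilityTheory.hasSubgaussianMGF_of_mem_Icc (μ := ν) (a := 0) (b := 1)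
      hmeas.aemeasurable (Filter.Eventually.of_forall fun x => by
        by_cases hx : x ∈ A <;> simp [hx])
    rwa [show ∫ x, A.indicator (fun _ => (1 : ℝ)) x ∂ν = ν.real A from
      integral_indicator_one hA] at h
  have hind := ProbabilityTheory.iIndepFun_pi (ι := Fin N) (μ := fun _ => ν)
    (X := fun _ x => A.indicator (fun _ => (1 : ℝ)) x - ν.real A)
    (fun _ => (hmeas.sub_const _).aemeasurable)
  have hsub' : ∀ i ∈ (Finset.univ : Finset (Fin N)), ProbabilityTheory.HasSubgaussianMGF
      (fun X : Fin N → Ω => A.indicator (fun _ => (1 : ℝ)) (X i) - ν.real A)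
      ((‖(1 : ℝ) - 0‖₊ / 2) ^ 2) (Measure.pi fun _ : Fin N => ν) := fun i _ => by
    have hmp := measurePreserving_eval (fun _ : Fin N => ν) i
    have h : ProbabilityTheory.HasSubgaussianMGF
        (fun x => A.indicator (fun _ => (1 : ℝ)) x - ν.real A) ((‖(1 : ℝ) - 0‖₊ / 2) ^ 2)
        ((Measure.pi fun _ : Fin N => ν).map (Function.eval i)) := hmp.map_eq.symm ▸ hsub
    exact h.of_map hmp.measurable.aemeasurable
  refine (ProbabilityTheory.HasSubgaussianMGF.measure_sum_ge_le_of_iIndepFun hind hsub'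
    (mul_nonneg N.cast_nonneg ht)).trans (le_of_eq ?_)
  have : (N : ℝ) ≠ 0 := by positivity
  -- An interval of length 1 gives variance proxy `1 / 4` per summand, so the exponent is `(N * t) ^
  -- 2 / (2 * N / 4) = 2 * N * t ^ 2`.
  congr 1
  simp only [sub_zero, nnnorm_one, Finset.sum_const, Finset.card_univ, Fintype.card_fin]
  push_cast
  field_simp
  norm_num
  ring

lemma integral_comp_fintype {T : Type*} [Fintype T] [MeasurableSpace T]
    [MeasurableSingletonClass T] (μ : Measure Ω) [IsFiniteMeasure μ] {τ : Ω → T}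
    (hτ : Measurable τ) (c : T → ℝ) : ∫ x, c (τ x) ∂μ = ∑ k, μ.real (τ ⁻¹' {k}) * c k := by
  rw [← integral_map hτ.aemeasurable (measurable_of_finite c).aestronglyMeasurable,
    integral_fintype .of_finite]
  refine Finset.sum_congr rfl fun k _ => ?_
  rw [map_measureReal_apply hτ (measurableSet_singleton k), smul_eq_mul]

lemma measureReal_preimage_finset {T : Type*} [Fintype T] [MeasurableSpace T]
    [MeasurableSingletonClass T] (μ : Measure Ω) [IsFiniteMeasure μ] {τ : Ω → T}
    (hτ : Measurable τ) (A : Finset T) :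
    μ.real (τ ⁻¹' (A : Set T)) = ∑ k ∈ A, μ.real (τ ⁻¹' {k}) := by
  rw [← map_measureReal_apply hτ A.measurableSet, ← sum_measureReal_singleton]
  exact Finset.sum_congr rfl fun k _ => map_measureReal_apply hτ (measurableSet_singleton k)

/-- Uniform law of large numbers, with a Gaussian tail, for all bounded functions of a discrete
statistic. -/
lemma exists_event_forall_step {T : Type*} [Fintype T] [MeasurableSpace T]
    [MeasurableSingletonClass T] (ν : Measure Ω) [IsProbabilityMeasure ν] {N : ℕ} (hN : 1 ≤ N)
    {τ : Ω → T} (hτ : Measurable τ) {t p : ℝ} (ht : 0 ≤ t)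
    (hp : 2 ^ Fintype.card T * Real.exp (-(2 * N * t ^ 2)) ≤ p) :
    ∃ U : Set (Fin N → Ω), MeasurableSet U ∧ 1 - p ≤ (Measure.pi fun _ : Fin N => ν).real U ∧
      ∀ X ∈ U, ∀ (c : T → ℝ) (M : ℝ), (∀ k, |c k| ≤ M) →
        |∫ x, c (τ x) ∂ν - 1 / (N : ℝ) * ∑ i, c (τ (X i))| ≤ 2 * M * t := by
  classical
  set P := Measure.pi fun _ : Fin N => ν
  let S : Finset T → Fin N → Ω → ℝ := fun A i x =>
    (τ ⁻¹' (A : Set T)).indicator (fun _ => (1 : ℝ)) x - ν.real (τ ⁻¹' (A : Set T))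
  let bad : Finset T → Set (Fin N → Ω) := fun A => {X | N * t ≤ ∑ i, S A i (X i)}
  have hpre : ∀ A : Finset T, MeasurableSet (τ ⁻¹' (A : Set T)) := fun A => hτ A.measurableSet
  have hbad : ∀ A, MeasurableSet (bad A) := fun A => by
    refine measurableSet_le measurable_const (Finset.measurable_sum _ fun i _ => ?_)
    exact ((measurable_const.indicator (hpre A)).comp (measurable_pi_apply i)).sub_const _
  refine ⟨(⋃ A, bad A)ᶜ, (MeasurableSet.iUnion hbad).compl, ?_, ?_⟩
  · rw [probReal_compl_eq_one_sub (MeasurableSet.iUnion hbad)]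
    have h1 : P.real (⋃ A, bad A) ≤ ∑ A : Finset T, P.real (bad A) := measureReal_iUnion_fintype_le _
    have h2 : ∑ A : Finset T, P.real (bad A) ≤
        ∑ _A : Finset T, Real.exp (-(2 * N * t ^ 2)) :=
      Finset.sum_le_sum fun A _ => measureReal_pi_frequency_ge_le ν hN (hpre A) ht
    rw [Finset.sum_const, Finset.card_univ, Fintype.card_finset, nsmul_eq_mul] at h2
    push_cast at h2
    linarith
  · intro X hX c M hM
    have hN0 : (0 : ℝ) < N := by positivity
    let d : T → ℝ := fun k =>
      1 / (N : ℝ) * ∑ i, (if τ (X i) = k then (1 : ℝ) else 0) - ν.real (τ ⁻¹' {k})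
    have hdA : ∀ A : Finset T, ∑ k ∈ A, d k = 1 / (N : ℝ) * ∑ i, S A i (X i) := fun A => by
      simp only [d, S, Finset.sum_sub_distrib, ← Finset.mul_sum, mul_sub]
      rw [measureReal_preimage_finset ν hτ A, Finset.sum_comm]
      congr 1
      · congr 1
        refine Finset.sum_congr rfl fun i _ => ?_
        rw [Finset.sum_ite_eq]
        simp [indicator_apply]
      · simp [hN0.ne']
    have hdle : ∀ A : Finset T, ∑ k ∈ A, d k ≤ t := fun A => by
      have : X ∉ bad A := fun h => hX (mem_iUnion.2 ⟨A, h⟩)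
      have h' : ∑ i, S A i (X i) < N * t := not_le.1 this
      rw [hdA, one_div, inv_mul_le_iff₀ hN0]
      exact h'.le
    have hd0 : ∑ k, d k = 0 := by
      rw [hdA]
      simp [S]
    -- The deviations sum to zero, so their `ℓ¹` norm is twice the sum over the cells where `d` is
    -- nonnegative. Hence upper tails suffice, provided they hold for every subset of `T`.
    have habs : ∑ k, |d k| ≤ 2 * t := by
      have h1 := Finset.sum_filter_add_sum_filter_not Finset.univ (fun k => 0 ≤ d k) d
      have h2 := Finset.sum_filter_add_sum_filter_not Finset.univ (fun k => 0 ≤ d k) fun k => |d k|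
      have h3 : ∑ k with 0 ≤ d k, |d k| = ∑ k with 0 ≤ d k, d k :=
        Finset.sum_congr rfl fun k hk => abs_of_nonneg (Finset.mem_filter.1 hk).2
      have h4 : ∑ k with ¬ 0 ≤ d k, |d k| = - ∑ k with ¬ 0 ≤ d k, d k := by
        rw [← Finset.sum_neg_distrib]
        exact Finset.sum_congr rfl fun k hk =>
          abs_of_neg (not_le.1 (Finset.mem_filter.1 hk).2)
      have h5 := hdle (Finset.univ.filter fun k => 0 ≤ d k)
      linarith
    have hmain : ∫ x, c (τ x) ∂ν - 1 / (N : ℝ) * ∑ i, c (τ (X i)) = - ∑ k, d k * c k := by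
      rw [integral_comp_fintype ν hτ c]
      simp only [d, sub_mul, Finset.sum_sub_distrib, mul_assoc, Finset.sum_mul, ← Finset.mul_sum]
      rw [Finset.sum_comm]
      simp [ite_mul]
    rw [hmain, abs_neg]
    calc |∑ k, d k * c k| ≤ ∑ k, |d k * c k| := Finset.abs_sum_le_sum_abs _ _
      _ ≤ ∑ k, |d k| * M := Finset.sum_le_sum fun k _ => by
          rw [abs_mul]; exact mul_le_mul_of_nonneg_left (hM k) (abs_nonneg _)
      _ = (∑ k, |d k|) * M := by rw [Finset.sum_mul]
      _ ≤ 2 * M * t := by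
          rcases isEmpty_or_nonempty T with hT | ⟨⟨k⟩⟩
          · exact (hT.false (τ (X ⟨0, hN⟩))).elim
          · have : 0 ≤ M := (abs_nonneg _).trans (hM k)
            nlinarith

end Statistics

/-! ### From cell frequencies to Lipschitz models and losses. -/

section Generalization

variable {Ω : Type*} [PseudoMetricSpace Ω] [MeasurableSpace Ω] [BorelSpace Ω]

/-- A finite cover by balls has a measurable choice of a ball containing a given point. -/
lemma exists_measurable_ball_index {κ : ℕ} {z : Fin κ → Ω} {e : ℝ}
    (hz : (⋃ i, Metric.ball (z i) e) = univ) :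
    ∃ j : Ω → Fin κ, Measurable j ∧ ∀ x, dist x (z (j x)) < e := by
  classical
  have hex : ∀ x, ∃ i, x ∈ Metric.ball (z i) e := fun x => by
    have : x ∈ ⋃ i, Metric.ball (z i) e := hz ▸ mem_univ x
    simpa using this
  -- Choosing the least index makes each fibre a ball minus finitely many earlier balls.
  refine ⟨fun x => Fin.find (fun i => x ∈ Metric.ball (z i) e) (hex x), ?_,
    fun x => Fin.find_spec (hex x)⟩
  refine measurable_to_countable' fun i => ?_
  have : (fun x => Fin.find (fun i => x ∈ Metric.ball (z i) e) (hex x)) ⁻¹' {i} =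
      Metric.ball (z i) e ∩ ⋂ j : Fin κ, ⋂ _ : j < i, (Metric.ball (z j) e)ᶜ := by
    ext x
    simp [Fin.find_eq_iff]
  rw [this]
  exact measurableSet_ball.inter
    (.iInter fun j => .iInter fun _ => measurableSet_ball.compl)

/-- A generalization bound, uniform over Lipschitz losses and Lipschitz models, for classification
on a bounded metric space covered by finitely many balls. -/
lemma exists_event_generalization (ν : Measure Ω) [IsProbabilityMeasure ν] {κ C N : ℕ}
    (hN : 1 ≤ N) {z : Fin κ → Ω} {e : ℝ} (hz : (⋃ i, Metric.ball (z i) e) = univ)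
    {cls : Ω → Fin C} (hcls : Measurable cls) {D : ℝ} (hD : ∀ x y : Ω, dist x y ≤ D)
    {t p : ℝ} (ht : 0 ≤ t) (hp : 2 ^ (κ * C) * Real.exp (-(2 * N * t ^ 2)) ≤ p) (L₁ L₂ : ℝ≥0) :
    ∃ U : Set (Fin N → Ω), MeasurableSet U ∧ 1 - p ≤ (Measure.pi fun _ : Fin N => ν).real U ∧
      ∀ X ∈ U, ∀ loss : (Fin C → ℝ) × (Fin C → ℝ) → ℝ, LipschitzWith L₂ loss →
      ∀ Υ : Ω → Fin C → ℝ, LipschitzWith L₁ Υ →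
        |∫ x, loss (Υ x, Pi.single (cls x) 1) ∂ν -
          1 / (N : ℝ) * ∑ i, loss (Υ (X i), Pi.single (cls (X i)) 1)| ≤
          2 * (L₁ * L₂) * e + 2 * (L₂ * (1 + L₁ * D)) * t := by
  obtain ⟨j, hj, hjd⟩ := exists_measurable_ball_index hz
  -- The class is part of the statistic because the target is not continuous in the point.
  obtain ⟨U, hU, hUp, hUX⟩ := exists_event_forall_step ν hN (τ := fun x => (j x, cls x))
    (hj.prodMk hcls) ht (by simpa using hp)
  refine ⟨U, hU, hUp, fun X hX loss hloss Υ hΥ => ?_⟩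
  have x₀ : Ω := X ⟨0, hN⟩
  have hD0 : 0 ≤ D := dist_nonneg.trans (hD x₀ x₀)
  have hsingle : ∀ i k : Fin C, dist (Pi.single i 1 : Fin C → ℝ) (Pi.single k 1) ≤ 1 := by
    intro i k
    refine (dist_pi_le_iff zero_le_one).2 fun l => ?_
    rw [Real.dist_eq]
    rw [Pi.single_apply, Pi.single_apply]
    split_ifs <;> simp
  have hdist : ∀ x y i k, |loss (Υ x, Pi.single i 1) - loss (Υ y, Pi.single k 1)| ≤
      L₂ * max (L₁ * dist x y) (dist (Pi.single i 1 : Fin C → ℝ) (Pi.single k 1)) := by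
    intro x y i k
    rw [← Real.dist_eq]
    refine (hloss.dist_le_mul _ _).trans (mul_le_mul_of_nonneg_left ?_ L₂.2)
    rw [Prod.dist_eq]
    exact max_le_max (hΥ.dist_le_mul x y) le_rfl
  set g : Ω → ℝ := fun x => loss (Υ x, Pi.single (cls x) 1) with hg
  -- Subtracting a constant does not change the difference of the risks, so only the oscillation of
  -- the loss enters, not its size.
  set b : ℝ := g x₀
  let c : Fin κ × Fin C → ℝ := fun k => loss (Υ (z k.1), Pi.single k.2 1) - b
  have hosc : ∀ x i, |loss (Υ x, Pi.single i 1) - b| ≤ L₂ * (1 + L₁ * D) := fun x i => by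
    refine (hdist x x₀ i (cls x₀)).trans (mul_le_mul_of_nonneg_left ?_ L₂.2)
    have h1 : (L₁ : ℝ) * dist x x₀ ≤ L₁ * D := mul_le_mul_of_nonneg_left (hD _ _) L₁.2
    have h2 : (0 : ℝ) ≤ L₁ * D := mul_nonneg L₁.2 hD0
    exact max_le (by linarith) ((hsingle _ _).trans (by linarith))
  have hc := hUX X hX c _ fun k => hosc (z k.1) k.2
  have hgc : ∀ x, |g x - b - c (j x, cls x)| ≤ L₁ * L₂ * e := fun x => by
    have h := hdist x (z (j x)) (cls x) (cls x)
    have h0 : (0 : ℝ) ≤ L₁ * dist x (z (j x)) := mul_nonneg L₁.2 dist_nonneg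
    rw [dist_self, max_eq_left h0] at h
    have h2 : (L₂ : ℝ) * (L₁ * dist x (z (j x))) ≤ L₂ * (L₁ * e) :=
      mul_le_mul_of_nonneg_left (mul_le_mul_of_nonneg_left (hjd x).le L₁.2) L₂.2
    have : g x - b - c (j x, cls x) =
        loss (Υ x, Pi.single (cls x) 1) - loss (Υ (z (j x)), Pi.single (cls x) 1) := by
      simp only [c, hg]; ring
    rw [this]
    linarith
  have hgm : Measurable g := by
    refine hloss.continuous.measurable.comp (hΥ.continuous.measurable.prodMk ?_)
    exact (measurable_of_finite fun i : Fin C => (Pi.single i 1 : Fin C → ℝ)).comp hcls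
  have hgi : Integrable (fun x => g x - b) ν :=
    Integrable.of_bound (hgm.sub_const _).aestronglyMeasurable _
      (Filter.Eventually.of_forall fun x => hosc x (cls x))
  have hci : Integrable (fun x => c (j x, cls x)) ν :=
    Integrable.of_bound ((measurable_of_finite c).comp (hj.prodMk hcls)).aestronglyMeasurable _
      (Filter.Eventually.of_forall fun x => hosc (z (j x)) (cls x))
  have hint : ∫ x, g x ∂ν = b + ∫ x, (g x - b) ∂ν := by
    have h := integral_add (integrable_const b) hgi
    simp only [add_sub_cancel] at h
    simpa using h
  have hN0 : (N : ℝ) ≠ 0 := by positivity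
  have hsum : 1 / (N : ℝ) * ∑ i, g (X i) = b + 1 / (N : ℝ) * ∑ i, (g (X i) - b) := by
    rw [Finset.sum_sub_distrib]
    simp only [Finset.sum_const, Finset.card_univ, Fintype.card_fin, nsmul_eq_mul]
    field_simp
    ring
  have h1 : |∫ x, (g x - b) ∂ν - ∫ x, c (j x, cls x) ∂ν| ≤ L₁ * L₂ * e := by
    rw [← integral_sub hgi hci]
    have := norm_integral_le_of_norm_le_const (μ := ν) (f := fun x => g x - b - c (j x, cls x))
      (Filter.Eventually.of_forall hgc)
    simpa using this
  have h2 : |1 / (N : ℝ) * ∑ i, (g (X i) - b) - 1 / (N : ℝ) * ∑ i, c (j (X i), cls (X i))| ≤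
      L₁ * L₂ * e := by
    rw [← mul_sub, ← Finset.sum_sub_distrib, abs_mul, abs_of_nonneg (by positivity)]
    have h := (Finset.abs_sum_le_sum_abs (fun i => g (X i) - b - c (j (X i), cls (X i)))
      Finset.univ).trans (Finset.sum_le_sum fun i _ => hgc (X i))
    simp only [Finset.sum_const, Finset.card_univ, Fintype.card_fin, nsmul_eq_mul] at h
    rw [one_div, inv_mul_le_iff₀ (by positivity)]
    exact h
  rw [hint, hsum]
  rw [abs_le] at h1 h2 hc ⊢
  constructor <;> linarith [h1.1, h1.2, h2.1, h2.2, hc.1, hc.2]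

end Generalization

/-! ### Measure preserving rearrangement of partitions into intervals. -/

section Rearrangement

/-- The distribution function of an atomless measure on the line is continuous. -/
lemma continuous_cdf_of_nullSingletonClass (μ : Measure ℝ) [IsProbabilityMeasure μ] [NullSingletonClass μ] :
    Continuous (ProbabilityTheory.cdf μ) := by
  refine continuous_iff_continuousAt.2 fun x => ?_
  refine (ProbabilityTheory.cdf μ).mono.continuousAt_iff_leftLim_eq_rightLim.2 ?_
  rw [StieltjesFunction.rightLim_eq]
  have h : μ {x} = 0 := measure_singleton x
  rw [← ProbabilityTheory.measure_cdf μ, StieltjesFunction.measure_singleton,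
    ENNReal.ofReal_eq_zero] at h
  have := (ProbabilityTheory.cdf μ).mono.leftLim_le (le_refl x)
  linarith

/-- The probability integral transform. For `0 < s < 1` the sublevel set is a nonempty half-line
bounded above, and by continuity the distribution function equals `s` at its endpoint. -/
lemma measure_cdf_le (μ : Measure ℝ) [IsProbabilityMeasure μ] [NullSingletonClass μ] {s : ℝ}
    (h0 : 0 < s) (h1 : s < 1) : μ.real {u | ProbabilityTheory.cdf μ u ≤ s} = s := by
  set F := ProbabilityTheory.cdf μ
  have hF : Continuous F := continuous_cdf_of_nullSingletonClass μ
  obtain ⟨l, hl⟩ := ((ProbabilityTheory.tendsto_cdf_atBot μ).eventually (gt_mem_nhds h0)).exists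
  obtain ⟨b, hb⟩ := ((ProbabilityTheory.tendsto_cdf_atTop μ).eventually (lt_mem_nhds h1)).exists
  have hlb : l ≤ b := le_of_lt (F.mono.reflect_lt (hl.trans hb))
  have hbd : BddAbove {u | F u ≤ s} :=
    ⟨b, fun u hu => le_of_lt (F.mono.reflect_lt (lt_of_le_of_lt hu hb))⟩
  obtain ⟨v, -, hv⟩ := intermediate_value_Icc hlb hF.continuousOn ⟨hl.le, hb.le⟩
  have hcl : IsClosed {u | F u ≤ s} := isClosed_le hF continuous_const
  have hmem : F (sSup {u | F u ≤ s}) ≤ s := hcl.csSup_mem ⟨l, hl.le⟩ hbd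
  have heq : {u | F u ≤ s} = Iic (sSup {u | F u ≤ s}) := by
    ext u
    exact ⟨fun hu => le_csSup hbd hu, fun hu => (F.mono hu).trans hmem⟩
  have hval : F (sSup {u | F u ≤ s}) = s :=
    le_antisymm hmem (hv.ge.trans (F.mono (le_csSup hbd hv.le)))
  rw [heq, ← ProbabilityTheory.cdf_eq_real, hval]

/-- The increasing rearrangement along an injective function: a measure preserving map of the unit
interval, injective up to a null set, which is monotone with respect to `h`. -/
lemma exists_conullBijection_monotone {h : I → ℝ} (hm : Measurable h)
    (hinj : Function.Injective h) :
    ∃ φ : ConullBijection, ∀ x y, h x ≤ h y → φ.toFun x ≤ φ.toFun y := by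
  set μ : Measure ℝ := (volume : Measure I).map h
  have : IsProbabilityMeasure μ := Measure.isProbabilityMeasure_map hm.aemeasurable
  -- Injectivity of `h` makes its law atomless, so `F ∘ h` is uniformly distributed.
  have : NullSingletonClass μ := ⟨fun u => by
    rw [Measure.map_apply hm (measurableSet_singleton u)]
    exact (subsingleton_singleton.preimage hinj).measure_zero _⟩
  set F := ProbabilityTheory.cdf μ
  let φ : I → I := fun x => ⟨F (h x), ProbabilityTheory.cdf_nonneg μ _, ProbabilityTheory.cdf_le_one μ _⟩
  have hφm : Measurable φ := (F.mono.measurable.comp hm).subtype_mk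
  have hmono : ∀ x y, h x ≤ h y → φ x ≤ φ y := fun x y hxy => F.mono hxy
  have hIio : ∀ s : I, 0 < (s : ℝ) → (s : ℝ) < 1 → volume.real (φ ⁻¹' Iic s) = s := by
    intro s h0 h1
    rw [← measure_cdf_le μ h0 h1, map_measureReal_apply hm
      (measurableSet_le F.mono.measurable measurable_const)]
    rfl
  have hmp : MeasurePreserving φ volume volume := by
    refine ⟨hφm, ?_⟩
    have : IsProbabilityMeasure ((volume : Measure I).map φ) :=
      Measure.isProbabilityMeasure_map hφm.aemeasurable
    refine Measure.ext_of_Iic _ _ fun s => ?_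
    rw [Measure.map_apply hφm measurableSet_Iic]
    refine (measureReal_eq_measureReal_iff (by finiteness) (by finiteness)).1 ?_
    have hv : volume.real (Iic s) = (s : ℝ) := by
      simp [measureReal_def, unitInterval.volume_Iic, ENNReal.toReal_ofReal s.2.1]
    rw [hv]
    rcases eq_or_lt_of_le s.2.2 with h1 | h1
    · have : Iic s = univ := eq_univ_of_forall fun x => by
        rw [mem_Iic, ← Subtype.coe_le_coe, h1]; exact x.2.2
      rw [this, preimage_univ, h1]
      simp
    rcases eq_or_lt_of_le s.2.1 with h0 | h0
    -- The endpoint `s = 0` is outside `measure_cdf_le`; it is squeezed by small positive levels.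
    · refine le_antisymm (le_of_forall_gt_imp_ge_of_dense fun b hb => ?_) (h0 ▸ measureReal_nonneg)
      have hb0 : 0 < b := h0 ▸ hb
      let b' : I := ⟨min b (1 / 2), by positivity, by linarith [min_le_right b (1 / 2 : ℝ)]⟩
      have hb' : (0 : ℝ) < b' := by simp only [b']; positivity
      have := hIio b' hb' (by simp only [b']; linarith [min_le_right b (1 / 2 : ℝ)])
      calc volume.real (φ ⁻¹' Iic s) ≤ volume.real (φ ⁻¹' Iic b') :=
            measureReal_mono (preimage_mono (Iic_subset_Iic.2
              (by rw [← Subtype.coe_le_coe, ← h0]; exact hb'.le)))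
        _ = b' := this
        _ ≤ b := min_le_left _ _
    · exact hIio s h0 h1
  -- If `φ x = φ y` with `h x < h y`, then `F` is constant between them and the common value is `F
  -- t` for a rational `t`. Discarding these countably many values costs a null set and makes `φ`
  -- injective.
  let D : Set I := φ ⁻¹' {s : I | ∃ t : ℚ, F t = s}ᶜ
  have hcount : {s : I | ∃ t : ℚ, F t = s}.Countable := by
    have : (range fun t : ℚ => F t).Countable := countable_range _
    refine (this.preimage (Subtype.val_injective (p := (· ∈ I)))).mono ?_
    rintro s ⟨t, ht⟩
    exact ⟨t, ht⟩
  have hDm : MeasurableSet D := hφm hcount.measurableSet.compl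
  have hDnull : volume Dᶜ = 0 := by
    have : Dᶜ = φ ⁻¹' {s : I | ∃ t : ℚ, F t = s} := by simp [D]
    rw [this, hmp.measure_preimage hcount.measurableSet.nullMeasurableSet]
    exact hcount.measure_zero _
  have hlt : ∀ x ∈ D, ∀ y, φ x = φ y → ¬ h x < h y := by
    intro x hx y hxy hlt
    obtain ⟨t, ht1, ht2⟩ := exists_rat_btwn hlt
    refine hx ⟨t, le_antisymm ?_ (F.mono ht1.le)⟩
    rw [hxy]
    exact F.mono ht2.le
  have hDinj : InjOn φ D := fun x hx y hy hxy =>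
    hinj (le_antisymm (not_lt.1 (hlt y hy x hxy.symm)) (not_lt.1 (hlt x hx y hxy)))
  have himg : ∀ S ⊆ D, MeasurableSet S → MeasurableSet (φ '' S) := fun S hS hSm =>
    hSm.image_of_measurable_injOn hφm (hDinj.mono hS)
  have himgv : ∀ S ⊆ D, MeasurableSet S → volume (φ '' S) = volume S := by
    intro S hS hSm
    rw [← hmp.measure_preimage (himg S hS hSm).nullMeasurableSet]
    refine measure_congr ?_
    have hD : ∀ᵐ x, x ∈ D := hDnull
    filter_upwards [hD] with x hx
    refine propext ⟨?_, fun h => mem_image_of_mem φ h⟩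
    rintro ⟨y, hy, hxy⟩
    rwa [← hDinj (hS hy) hx hxy]
  refine ⟨⟨φ, D, φ '' D, hφm, hDm, himg D subset_rfl hDm, hDnull, ?_, hDinj.bijOn_image, himgv⟩,
    hmono⟩
  rw [prob_compl_eq_zero_iff (himg D subset_rfl hDm), himgv D subset_rfl hDm,
    ← prob_compl_eq_zero_iff hDm, hDnull]

/-- A finite measurable partition of the unit interval can be rearranged into consecutive
intervals. -/
lemma exists_conullBijection_sort {n : ℕ} {q : I → Fin n} (hq : Measurable q) :
    ∃ φ : ConullBijection, ∀ x y, q x < q y → φ.toFun x ≤ φ.toFun y := by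
  have hlt : ∀ x y, q x < q y → (q x : ℝ) + x / 2 < (q y : ℝ) + y / 2 := by
    intro x y hxy
    have h1 : ((q x : ℕ) : ℝ) + 1 ≤ (q y : ℕ) := by exact_mod_cast Fin.lt_def.1 hxy
    linarith [x.2.2, y.2.1]
  -- Since `x / 2` is less than the gap 1 between labels, this function is injective and orders
  -- points first by `q`, then by position.
  obtain ⟨φ, hφ⟩ := exists_conullBijection_monotone (h := fun x => (q x : ℝ) + x / 2)
    (((measurable_of_finite fun i : Fin n => (i : ℝ)).comp hq).add
      (measurable_subtype_coe.div_const 2)) (by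
      intro x y hxy
      rcases lt_trichotomy (q x) (q y) with h | h | h
      · exact absurd hxy (hlt x y h).ne
      · simp only [h] at hxy
        exact Subtype.ext (by linarith)
      · exact absurd hxy (hlt y x h).ne')
  exact ⟨φ, fun x y hxy => hφ x y (hlt x y hxy).le⟩

/-- The index of the cell of a point in the partition of the unit interval into `K` intervals of
equal length. -/
def gridIndex (K : ℕ) [NeZero K] (x : I) : Fin K :=
  -- The minimum puts the endpoint 1 into the last cell.
  Fin.ofNat K (min ⌊(K : ℝ) * x⌋₊ (K - 1))

lemma gridIndex_val (K : ℕ) [NeZero K] (x : I) :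
    (gridIndex K x : ℕ) = min ⌊(K : ℝ) * x⌋₊ (K - 1) := by
  have := NeZero.pos K
  exact Nat.mod_eq_of_lt (by omega)

lemma gridIndex_mono (K : ℕ) [NeZero K] {x y : I} (h : x ≤ y) : gridIndex K x ≤ gridIndex K y := by
  rw [Fin.le_def, gridIndex_val, gridIndex_val]
  exact min_le_min_right _ (Nat.floor_le_floor (mul_le_mul_of_nonneg_left h K.cast_nonneg))

lemma measurable_gridIndex (K : ℕ) [NeZero K] : Measurable (gridIndex K) :=
  (measurable_of_countable fun k : ℕ => Fin.ofNat K (min k (K - 1))).comp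
    (Nat.measurable_floor.comp (measurable_subtype_coe.const_mul _))

lemma volume_gridIndex_le (K : ℕ) [NeZero K] (b : Fin K) :
    volume.real (gridIndex K ⁻¹' {b}) ≤ 1 / K := by
  have hK : (0 : ℝ) < K := by exact_mod_cast NeZero.pos K
  have hb : ((b : ℕ) : ℝ) + 1 ≤ K := by exact_mod_cast b.2
  let l : I := ⟨b / K, by positivity, by rw [div_le_one hK]; linarith⟩
  let u : I := ⟨(b + 1) / K, by positivity, by rw [div_le_one hK]; linarith⟩
  have hsub : gridIndex K ⁻¹' {b} ⊆ Icc l u := by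
    intro x hx
    have hx' : (b : ℕ) = min ⌊(K : ℝ) * x⌋₊ (K - 1) := by
      rw [← gridIndex_val]; exact congrArg Fin.val (Eq.symm hx)
    have h0 : (0 : ℝ) ≤ K * x := mul_nonneg hK.le x.2.1
    constructor
    · rw [← Subtype.coe_le_coe, div_le_iff₀ hK, mul_comm]
      exact le_trans (by rw [hx']; exact_mod_cast min_le_left _ _) (Nat.floor_le h0)
    · rw [← Subtype.coe_le_coe, le_div_iff₀ hK, mul_comm]
      rcases min_cases ⌊(K : ℝ) * x⌋₊ (K - 1) with ⟨h, -⟩ | ⟨h, -⟩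
      · rw [hx', h]
        exact (Nat.lt_floor_add_one _).le
      · have : (b : ℕ) + 1 = K := by have := NeZero.pos K; omega
        have : ((b : ℕ) : ℝ) + 1 = K := by exact_mod_cast this
        rw [this]
        nlinarith [x.2.2]
  refine (measureReal_mono hsub).trans (le_of_eq ?_)
  rw [measureReal_def, unitInterval.volume_Icc, ENNReal.toReal_ofReal]
  · simp only [l, u]; ring
  · simp only [l, u, sub_nonneg]
    gcongr
    linarith

/-- Any partition into `n` measurable parts agrees, after rearrangement and up to a set of measure
`n / K`, with a coarsening of the equipartition into `K` intervals. -/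
lemma exists_conullBijection_grid {n : ℕ} {q : I → Fin n} (hq : Measurable q) (K : ℕ) [NeZero K] :
    ∃ (φ : ConullBijection) (c : Fin K → Fin n),
      volume.real {x | q x ≠ c (gridIndex K (φ.toFun x))} ≤ n / K := by
  classical
  obtain ⟨φ, hφ⟩ := exists_conullBijection_sort hq
  let J : I → Fin K := fun x => gridIndex K (φ.toFun x)
  have hJm : Measurable J := (measurable_gridIndex K).comp φ.measurable_toFun
  have hn : Nonempty (Fin n) := ⟨q 0⟩
  have hJ : ∀ x y, q x < q y → J x ≤ J y := fun x y h => gridIndex_mono K (hφ x y h)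
  -- A cell is labelled by the least value of `q` occurring in it, arbitrarily if no point lands
  -- there.
  have hc : ∀ b : Fin K, ∃ i : Fin n, (∃ x, J x = b) → (∃ x, J x = b ∧ q x = i) ∧
      ∀ x, J x = b → i ≤ q x := by
    intro b
    by_cases hb : ∃ x, J x = b
    · have hne : (q '' (J ⁻¹' {b})).Nonempty := by
        obtain ⟨x, hx⟩ := hb
        exact ⟨q x, x, hx, rfl⟩
      obtain ⟨i, ⟨x, hx, hxi⟩, hmin⟩ := (toFinite (q '' (J ⁻¹' {b}))).exists_minimal hne
      refine ⟨i, fun _ => ⟨⟨x, hx, hxi⟩, fun y hy => ?_⟩⟩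
      rcases le_total i (q y) with h | h
      · exact h
      · exact hmin ⟨y, hy, rfl⟩ h
    · exact ⟨hn.some, fun h => absurd h hb⟩
  choose c hc using hc
  let bad : Finset (Fin K) := Finset.univ.filter fun b => ∃ x, J x = b ∧ q x ≠ c b
  have hcard : bad.card ≤ n := by
    -- Let two bad cells `b`, `b'` have the same least label. A point of `b` has a larger label, a
    -- point of `b'` attains the least one, so sortedness gives `b' ≤ b`, and by symmetry equality.
    -- Hence there are at most as many bad cells as labels.
    have : Set.InjOn c bad := by
      have key : ∀ b ∈ bad, ∀ b' ∈ bad, c b = c b' → b' ≤ b := by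
        intro b hb b' hb' hbb
        obtain ⟨y, hy, hyc⟩ := (Finset.mem_filter.1 hb).2
        obtain ⟨y', hy', -⟩ := (Finset.mem_filter.1 hb').2
        obtain ⟨x', hx', hxc⟩ := (hc b' ⟨y', hy'⟩).1
        have hlt : q x' < q y := by
          rw [hxc, ← hbb]
          exact lt_of_le_of_ne ((hc b ⟨y, hy⟩).2 y hy) (Ne.symm hyc)
        have := hJ x' y hlt
        rwa [hx', hy] at this
      intro b hb b' hb' h
      exact le_antisymm (key b' hb' b hb h.symm) (key b hb b' hb' h)
    simpa using Finset.card_le_card_of_injOn c (t := Finset.univ) (fun _ _ => Finset.mem_coe.2 (Finset.mem_univ _)) this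
  refine ⟨φ, c, ?_⟩
  have hsub : {x | q x ≠ c (J x)} ⊆ ⋃ b ∈ bad, J ⁻¹' {b} := by
    intro x hx
    exact mem_iUnion₂.2 ⟨J x, Finset.mem_filter.2 ⟨Finset.mem_univ _, x, rfl, hx⟩, rfl⟩
  have hcell : ∀ b, volume.real (J ⁻¹' {b}) ≤ 1 / K := fun b => by
    have := φ.measurePreserving.measureReal_preimage
      (measurable_gridIndex K (measurableSet_singleton b)).nullMeasurableSet
    exact (le_of_eq this).trans (volume_gridIndex_le K b)
  calc volume.real {x | q x ≠ c (J x)} ≤ volume.real (⋃ b ∈ bad, J ⁻¹' {b}) :=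
          measureReal_mono hsub (measure_ne_top _ _)
    _ ≤ ∑ b ∈ bad, volume.real (J ⁻¹' {b}) := measureReal_biUnion_finset_le _ _
    _ ≤ ∑ _b ∈ bad, (1 / K : ℝ) := Finset.sum_le_sum fun b _ => hcell b
    _ = bad.card * (1 / K) := by simp
    _ ≤ n / K := by
      rw [mul_one_div]
      gcongr

end Rearrangement

/-! ### Conditional averages as an `L²` projection. -/

section CellAverage

variable {Ω T : Type*} [MeasurableSpace Ω]

/-- The average of `F` over the cell `{τ = k}`. -/
def cellAverage (μ : Measure Ω) (F : Ω → ℝ) (τ : Ω → T) (k : T) : ℝ :=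
  ⨍ z in τ ⁻¹' {k}, F z ∂μ

lemma cellAverage_mem_Icc {μ : Measure Ω} [IsFiniteMeasure μ] {F : Ω → ℝ} (hF : Measurable F)
    (h01 : ∀ z, F z ∈ Icc (0 : ℝ) 1) (τ : Ω → T) (k : T) :
    cellAverage μ F τ k ∈ Icc (0 : ℝ) 1 := by
  have hi : Integrable F μ := BM.integrable
    ⟨hF, 1, fun z => abs_le.2 ⟨by linarith [(h01 z).1], (h01 z).2⟩⟩ μ
  rw [cellAverage, setAverage_eq, smul_eq_mul]
  have h0 : 0 ≤ ∫ z in τ ⁻¹' {k}, F z ∂μ := integral_nonneg fun z => (h01 z).1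
  have h1 : ∫ z in τ ⁻¹' {k}, F z ∂μ ≤ μ.real (τ ⁻¹' {k}) := by
    have := integral_mono (μ := μ.restrict (τ ⁻¹' {k})) hi.integrableOn
      (integrable_const (1 : ℝ)) fun z => (h01 z).2
    simpa using this
  exact ⟨mul_nonneg (inv_nonneg.2 measureReal_nonneg) h0,
    inv_mul_le_one_of_le₀ h1 measureReal_nonneg⟩

variable [Fintype T] [MeasurableSpace T] [MeasurableSingletonClass T]
  {μ : Measure Ω} [IsFiniteMeasure μ] {τ : Ω → T}

lemma BM.comp_fintype (hτ : Measurable τ) (H : T → ℝ) : BM fun z => H (τ z) :=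
  ⟨(measurable_of_finite H).comp hτ, ∑ k, |H k|, fun z =>
    Finset.single_le_sum (f := fun k => |H k|) (fun _ _ => abs_nonneg _) (Finset.mem_univ (τ z))⟩

lemma BM.mul {F G : Ω → ℝ} (hF : BM F) (hG : BM G) : BM fun z => F z * G z := by
  obtain ⟨hm, M, hM⟩ := hF
  obtain ⟨hm', M', hM'⟩ := hG
  exact ⟨hm.mul hm', M * M', fun z => by
    rw [abs_mul]
    exact mul_le_mul (hM z) (hM' z) (abs_nonneg _) ((abs_nonneg _).trans (hM z))⟩

lemma integral_mul_comp_fintype {F : Ω → ℝ} (hF : BM F) (hτ : Measurable τ) (H : T → ℝ) :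
    ∫ z, F z * H (τ z) ∂μ = ∑ k, (∫ z in τ ⁻¹' {k}, F z ∂μ) * H k := by
  classical
  have hk : ∀ k, MeasurableSet (τ ⁻¹' {k}) := fun k => hτ (measurableSet_singleton k)
  have h : ∀ z, F z * H (τ z) = ∑ k, (τ ⁻¹' {k}).indicator F z * H k := fun z => by
    rw [Finset.sum_eq_single (τ z)]
    · simp
    · intro k _ hkz
      rw [indicator_of_notMem, zero_mul]
      simpa using hkz.symm
    · simp
  simp only [h]
  rw [integral_finsetSum _ fun k _ => ((hF.integrable μ).indicator (hk k)).mul_const _]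
  refine Finset.sum_congr rfl fun k _ => ?_
  rw [integral_mul_const, integral_indicator (hk k)]

/-- Orthogonality: the residual has zero integral over each cell, so it is orthogonal to every
function that is constant on cells. -/
lemma integral_sub_cellAverage_mul {F : Ω → ℝ} (hF : BM F) (hτ : Measurable τ) (H : T → ℝ) :
    ∫ z, (F z - cellAverage μ F τ (τ z)) * H (τ z) ∂μ = 0 := by
  rw [integral_mul_comp_fintype (hF.sub (BM.comp_fintype hτ _)) hτ]
  refine Finset.sum_eq_zero fun k _ => ?_
  have hk : MeasurableSet (τ ⁻¹' {k}) := hτ (measurableSet_singleton k)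
  have h : ∫ z in τ ⁻¹' {k}, cellAverage μ F τ (τ z) ∂μ = ∫ z in τ ⁻¹' {k}, F z ∂μ := by
    rw [← setIntegral_setAverage μ F]
    refine setIntegral_congr_fun hk fun z hz => ?_
    rw [mem_preimage, mem_singleton_iff] at hz
    simp only [hz]
    rfl
  rw [integral_sub (hF.integrable _) ((BM.comp_fintype hτ _).integrable _), h, sub_self, zero_mul]

/-- Cell averages are the best approximation in `L²` by functions that are constant on cells. -/
lemma integral_sub_cellAverage_sq_le {F : Ω → ℝ} (hF : BM F) (hτ : Measurable τ) (H : T → ℝ) :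
    ∫ z, (F z - cellAverage μ F τ (τ z)) ^ 2 ∂μ ≤ ∫ z, (F z - H (τ z)) ^ 2 ∂μ := by
  set A := cellAverage μ F τ
  have hG : BM fun z => F z - A (τ z) := hF.sub (BM.comp_fintype hτ A)
  -- This is the cross term in the expansion of `(F - H) ^ 2` around `A`; the remaining term `(A -
  -- H) ^ 2` is nonnegative.
  have h0 := integral_sub_cellAverage_mul (μ := μ) hF hτ fun k => 2 * (A k - H k)
  have hint : Integrable (fun z => (F z - A (τ z)) ^ 2) μ := by
    simpa only [sq] using (hG.mul hG).integrable μ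
  have hint' : Integrable (fun z => (F z - A (τ z)) * (2 * (A (τ z) - H (τ z)))) μ :=
    (hG.mul (BM.comp_fintype hτ fun k => 2 * (A k - H k))).integrable μ
  have hint'' : Integrable (fun z => (F z - H (τ z)) ^ 2) μ := by
    have hB : BM fun z => F z - H (τ z) := hF.sub (BM.comp_fintype hτ H)
    simpa only [sq] using (hB.mul hB).integrable μ
  have h := integral_mono (hint.add hint') hint'' fun z => by
    have : 0 ≤ (A (τ z) - H (τ z)) ^ 2 := sq_nonneg _
    simp only [Pi.add_apply]
    nlinarith
  rw [integral_add' hint hint', h0, add_zero] at h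
  exact h

end CellAverage

/-! ### Weak regularity by energy decrement. -/

section Regularity

/-- The cell of a pair of points in the square of a partition of the unit interval. -/
def pairIndex {ι : Type*} (q : I → ι) (z : I × I) : ι × ι := (q z.1, q z.2)

lemma measurable_pairIndex {n : ℕ} {q : I → Fin n} (hq : Measurable q) :
    Measurable (pairIndex q) :=
  (hq.comp measurable_fst).prodMk (hq.comp measurable_snd)

/-- The energy decrement: splitting all cells along a rectangle that witnesses a large cut norm
decreases the squared `L²` distance to the averages. -/
lemma exists_refinement {F : I × I → ℝ} (hF : BM F) {n : ℕ} {q : I → Fin n} (hq : Measurable q)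
    {η : ℝ} (hη : 0 < η)
    (hcut : η < supInt volume rect fun z => F z - cellAverage volume F (pairIndex q) (pairIndex q z)) :
    ∃ q' : I → Fin (n * 4), Measurable q' ∧
      ∫ z, (F z - cellAverage volume F (pairIndex q') (pairIndex q' z)) ^ 2 ≤
        (∫ z, (F z - cellAverage volume F (pairIndex q) (pairIndex q z)) ^ 2) - η ^ 2 := by
  classical
  set A := cellAverage volume F (pairIndex q)
  obtain ⟨⟨⟨S, hS⟩, ⟨T, hT⟩⟩, hST⟩ := exists_lt_of_lt_ciSup hcut
  simp only at hST
  set R : Set (I × I) := S ×ˢ T with hR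
  have hRm : MeasurableSet R := hS.prod hT
  set c : ℝ := ∫ z in R, (F z - A (pairIndex q z)) with hc
  let e : Fin n × Bool × Bool ≃ Fin (n * 4) := Fintype.equivFinOfCardEq (by simp)
  let q' : I → Fin (n * 4) := fun x => e (q x, decide (x ∈ S), decide (x ∈ T))
  have hq' : Measurable q' := (measurable_of_finite e).comp (hq.prodMk
    ((measurable_to_bool (by simpa [preimage] using hS)).prodMk
      (measurable_to_bool (by simpa [preimage] using hT))))
  refine ⟨q', hq', ?_⟩
  -- The competitor adds the constant `c` on `R`, which is a union of refined cells. The energy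
  -- changes by `-2 * c ^ 2 + c ^ 2 * volume.real R ≤ -c ^ 2`.
  let H : Fin (n * 4) × Fin (n * 4) → ℝ := fun k =>
    A ((e.symm k.1).1, (e.symm k.2).1) +
      if (e.symm k.1).2.1 = true ∧ (e.symm k.2).2.2 = true then c else 0
  refine (integral_sub_cellAverage_sq_le hF (measurable_pairIndex hq') H).trans ?_
  have hG : BM fun z => F z - A (pairIndex q z) :=
    hF.sub (BM.comp_fintype (measurable_pairIndex hq) A)
  have hH : ∀ z, (F z - H (pairIndex q' z)) ^ 2 =
      (F z - A (pairIndex q z)) ^ 2 - 2 * c * R.indicator (fun z => F z - A (pairIndex q z)) z +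
        c ^ 2 * R.indicator (fun _ => 1) z := by
    intro z
    by_cases hz : z ∈ R
    · have hz' : z.1 ∈ S ∧ z.2 ∈ T := hz
      simp only [H, pairIndex, q', Equiv.symm_apply_apply, indicator_of_mem hz, hz'.1, hz'.2,
        decide_true, and_self, if_true]
      ring
    · have hz' : ¬ (z.1 ∈ S ∧ z.2 ∈ T) := hz
      simp only [H, pairIndex, q', Equiv.symm_apply_apply, indicator_of_notMem hz,
        decide_eq_true_eq, if_neg hz']
      ring
  simp only [hH]
  have i1 : Integrable (fun z => (F z - A (pairIndex q z)) ^ 2) := by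
    simpa only [sq] using (hG.mul hG).integrable volume
  have i2 : Integrable (fun z => 2 * c * R.indicator (fun z => F z - A (pairIndex q z)) z) :=
    ((hG.integrable volume).indicator hRm).const_mul _
  have i3 : Integrable (fun z : I × I => c ^ 2 * R.indicator (fun _ => (1 : ℝ)) z) :=
    ((integrable_const (1 : ℝ)).indicator hRm).const_mul _
  have i12 : Integrable (fun z => (F z - A (pairIndex q z)) ^ 2 -
      2 * c * R.indicator (fun z => F z - A (pairIndex q z)) z) := i1.sub i2
  rw [integral_add i12 i3, integral_sub i1 i2, integral_const_mul, integral_const_mul,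
    integral_indicator hRm, ← hc, show ∫ z, R.indicator (fun _ => (1 : ℝ)) z = volume.real R from
    integral_indicator_one hRm]
  have hvol : volume.real R ≤ 1 := measureReal_le_one
  have hcη : η ^ 2 ≤ c ^ 2 := by
    rw [← sq_abs c]
    exact pow_le_pow_left₀ hη.le hST.le 2
  nlinarith [sq_nonneg c]

/-- Weak regularity: a kernel with values in `[0, 1]` is close in cut norm to its averages over a
partition of bounded size. -/
lemma exists_cellAverage_cutNorm_le {F : I × I → ℝ} (hF : Measurable F)
    (h01 : ∀ z, F z ∈ Icc (0 : ℝ) 1) {η : ℝ} (hη : 0 < η) {m : ℕ} (hm : 1 / 4 < m * η ^ 2) :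
    ∃ n ≤ 4 ^ m, ∃ q : I → Fin n, Measurable q ∧
      supInt volume rect
        (fun z => F z - cellAverage volume F (pairIndex q) (pairIndex q z)) ≤ η := by
  by_contra! hcon
  have hFB : BM F := ⟨hF, 1, fun z => abs_le.2 ⟨by linarith [(h01 z).1], (h01 z).2⟩⟩
  -- The trivial partition has energy at most `1 / 4`, by comparison with the constant `1 / 2`. Each
  -- failure costs `η ^ 2`, so `m` failures would make the energy negative.
  have key : ∀ l ≤ m, ∃ q : I → Fin (4 ^ l), Measurable q ∧
      ∫ z, (F z - cellAverage volume F (pairIndex q) (pairIndex q z)) ^ 2 ≤ 1 / 4 - l * η ^ 2 := by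
    intro l
    induction l with
    | zero =>
      intro _
      refine ⟨fun _ => ⟨0, by simp⟩, measurable_const, ?_⟩
      refine (integral_sub_cellAverage_sq_le hFB (measurable_pairIndex measurable_const)
        fun _ => 1 / 2).trans ?_
      have hB : BM fun z => F z - 1 / 2 := ⟨hF.sub_const _, 1, fun z =>
        abs_le.2 ⟨by linarith [(h01 z).1], by linarith [(h01 z).2]⟩⟩
      have := integral_mono (μ := (volume : Measure (I × I))) (g := fun _ => (1 / 4 : ℝ))
        (by simpa only [sq] using (hB.mul hB).integrable volume) (integrable_const _)
        (fun z => show (F z - 1 / 2) ^ 2 ≤ 1 / 4 by nlinarith [(h01 z).1, (h01 z).2])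
      simpa using this
    | succ l ih =>
      intro hl
      obtain ⟨q, hq, hE⟩ := ih (by omega)
      obtain ⟨q', hq', hE'⟩ := exists_refinement hFB hq hη
        (hcon _ (Nat.pow_le_pow_right (by norm_num) (by omega)) q hq)
      refine ⟨q', hq', hE'.trans ?_⟩
      push_cast
      linarith
  obtain ⟨q, -, hE⟩ := key m le_rfl
  have : 0 ≤ ∫ z, (F z - cellAverage volume F (pairIndex q) (pairIndex q z)) ^ 2 :=
    integral_nonneg fun z => sq_nonneg _
  linarith

/-- Weak regularity for graphons, in terms of symmetric step functions. -/
lemma GraphonSignal.exists_step_cutNorm_le {r : ℝ} (u : GraphonSignal r) {η : ℝ} (hη : 0 < η)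
    {m : ℕ} (hm : 1 / 4 < m * η ^ 2) :
    ∃ q : I → Fin (4 ^ m), Measurable q ∧ ∃ w : Fin (4 ^ m) → Fin (4 ^ m) → ℝ,
      (∀ i j, w i j = w j i) ∧ (∀ i j, w i j ∈ Icc (0 : ℝ) 1) ∧
      supInt volume rect (fun z : I × I => u.W z.1 z.2 - w (q z.1) (q z.2)) ≤ η := by
  obtain ⟨n, hn, q, hq, hcut⟩ :=
    exists_cellAverage_cutNorm_le u.measurable_W (fun z => u.W_mem z.1 z.2) hη hm
  have : Nonempty (Fin n) := ⟨q 0⟩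
  set F : I × I → ℝ := fun z => u.W z.1 z.2
  -- The `n` parts are padded to `4 ^ m` labels; surplus labels repeat an existing part, which
  -- preserves symmetry and range.
  have hinv : ∀ i, Function.invFun (Fin.castLE hn) (Fin.castLE hn i) = i :=
    Function.leftInverse_invFun (Fin.castLE_injective hn)
  have hsymm : ∀ i j, cellAverage volume F (pairIndex q) (i, j) =
      cellAverage volume F (pairIndex q) (j, i) := by
    intro i j
    have hpre : ∀ i j, pairIndex q ⁻¹' {(i, j)} = (q ⁻¹' {i}) ×ˢ (q ⁻¹' {j}) := fun i j => by
      ext z; simp [pairIndex]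
    have hswap := setIntegral_prod_swap (μ := (volume : Measure I)) (ν := (volume : Measure I))
      (q ⁻¹' {i}) (q ⁻¹' {j}) F
    simp only [cellAverage, setAverage_eq, hpre, measureReal_def, Measure.volume_eq_prod,
      Measure.prod_prod]
    rw [← hswap, mul_comm (volume (q ⁻¹' {i}))]
    congr 2
    ext z
    exact u.symm_W z.2 z.1
  refine ⟨fun x => Fin.castLE hn (q x), (measurable_of_finite (Fin.castLE hn)).comp hq,
    fun i j => cellAverage volume F (pairIndex q)
      (Function.invFun (Fin.castLE hn) i, Function.invFun (Fin.castLE hn) j),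
    fun i j => hsymm _ _, fun i j => cellAverage_mem_Icc u.measurable_W (fun z => u.W_mem z.1 z.2) _ _, ?_⟩
  simp only [hinv]
  exact hcut

end Regularity

/-! ### Covering numbers of the graphon-signal space. -/

section Cover

lemma supInt_le_integral {Ω ι : Type*} [MeasurableSpace Ω] {μ : Measure Ω} [IsFiniteMeasure μ]
    (s : ι → Set Ω) {F G : Ω → ℝ} (hG : Integrable G μ) (h : ∀ z, |F z| ≤ G z) :
    supInt μ s F ≤ ∫ z, G z ∂μ := by
  have hG0 : ∀ z, 0 ≤ G z := fun z => (abs_nonneg _).trans (h z)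
  refine Real.iSup_le (fun i => ?_) (integral_nonneg hG0)
  refine (norm_integral_le_of_norm_le (f := F) hG.integrableOn
    (Filter.Eventually.of_forall h)).trans ?_
  exact setIntegral_le_integral hG (Filter.Eventually.of_forall hG0)

lemma cutDist_le_diam {r : ℝ} (u v : GraphonSignal r) : cutDist u v ≤ 1 + 2 * r := by
  refine (cutDist_le u v ConullBijection.refl).trans (add_le_add ?_ ?_)
  · rw [kernel_eq]
    refine (supInt_le_integral (G := fun _ => (1 : ℝ)) rect (integrable_const _) fun z => ?_).trans
      (by simp)
    have h1 := u.W_mem z.1 z.2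
    have h2 := v.W_mem (ConullBijection.refl.toFun z.1) (ConullBijection.refl.toFun z.2)
    exact abs_le.2 ⟨by linarith [h1.1, h2.2], by linarith [h1.2, h2.1]⟩
  · rw [signal_eq]
    refine (supInt_le_integral (G := fun _ => 2 * r) _ (integrable_const _) fun x => ?_).trans
      (by simp)
    have h1 := abs_le.1 (u.abs_f_le x)
    have h2 := abs_le.1 (v.abs_f_le (ConullBijection.refl.toFun x))
    exact abs_le.2 ⟨by linarith, by linarith⟩

/-- The codes of discretized step graphon-signals: each of the `K` cells of the unit interval gets
one of `n` kernel types and one of `M + 1` signal levels, and each pair of types a kernel level. -/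
abbrev StepCode (n M K : ℕ) : Type := (Fin K → Fin n × Fin (M + 1)) × (Fin n → Fin n → Fin (M + 1))

/-- The kernel of a code, as a function of the cells. -/
def stepKernel {n M K : ℕ} (d : StepCode n M K) (k : Fin K × Fin K) : ℝ :=
  -- Averaging both orders makes every code a symmetric kernel, so codes need no symmetry
  -- constraint.
  ((d.2 (d.1 k.1).1 (d.1 k.2).1 : ℕ) + (d.2 (d.1 k.2).1 (d.1 k.1).1 : ℕ) : ℝ) / (2 * M)

/-- The signal of a code, as a function of the cells. -/
def stepSignal {n M K : ℕ} (r : ℝ) (d : StepCode n M K) (k : Fin K) : ℝ :=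
  -r + 2 * r * ((d.1 k).2 : ℕ) / M

lemma stepKernel_mem_Icc {n M K : ℕ} (d : StepCode n M K) (k : Fin K × Fin K) :
    stepKernel d k ∈ Icc (0 : ℝ) 1 := by
  unfold stepKernel
  refine ⟨by positivity, div_le_one_of_le₀ ?_ (by positivity)⟩
  have h : ∀ i j, ((d.2 i j : ℕ) : ℝ) ≤ M := fun i j => by
    exact_mod_cast Nat.lt_succ_iff.1 (d.2 i j).2
  linarith [h (d.1 k.1).1 (d.1 k.2).1, h (d.1 k.2).1 (d.1 k.1).1]

lemma abs_stepSignal_le {n M K : ℕ} {r : ℝ} (hr : 0 ≤ r) (d : StepCode n M K) (k : Fin K) :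
    |stepSignal r d k| ≤ r := by
  unfold stepSignal
  have h : (((d.1 k).2 : ℕ) : ℝ) ≤ M := by exact_mod_cast Nat.lt_succ_iff.1 (d.1 k).2.2
  have h1 : (((d.1 k).2 : ℕ) : ℝ) / M ≤ 1 := div_le_one_of_le₀ h (by positivity)
  have h2 : 0 ≤ 2 * r * (((d.1 k).2 : ℕ) : ℝ) / M := by positivity
  have h3 : 2 * r * (((d.1 k).2 : ℕ) : ℝ) / M ≤ 2 * r := by
    rw [mul_div_assoc]
    exact mul_le_of_le_one_right (by positivity) h1
  exact abs_le.2 ⟨by linarith, by linarith⟩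

/-- The step graphon-signal with a given code. -/
def stepGraphonSignal {n M K : ℕ} [NeZero K] {r : ℝ} (hr : 0 ≤ r) (d : StepCode n M K) :
    GraphonSignal r where
  W x y := stepKernel d (gridIndex K x, gridIndex K y)
  f x := stepSignal r d (gridIndex K x)
  measurable_W := (measurable_of_finite (stepKernel d)).comp
    (((measurable_gridIndex K).comp measurable_fst).prodMk
      ((measurable_gridIndex K).comp measurable_snd))
  symm_W x y := by rw [stepKernel, stepKernel, add_comm]
  W_mem x y := stepKernel_mem_Icc d _
  measurable_f := (measurable_of_finite (stepSignal r d)).comp (measurable_gridIndex K)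
  abs_f_le x := abs_stepSignal_le hr d _

/-- The integer part of `M t`, for `t ∈ [0, 1]`. -/
def level (M : ℕ) (t : ℝ) : Fin (M + 1) := Fin.ofNat (M + 1) ⌊t * M⌋₊

lemma measurable_level (M : ℕ) : Measurable (level M) :=
  (measurable_of_countable (Fin.ofNat (M + 1))).comp
    (Nat.measurable_floor.comp (measurable_id.mul_const _))

lemma abs_sub_level_le {M : ℕ} (hM : 0 < M) {t : ℝ} (ht : t ∈ Icc (0 : ℝ) 1) :
    |t - (level M t : ℕ) / M| ≤ 1 / M := by
  have hM' : (0 : ℝ) < M := by exact_mod_cast hM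
  have h0 : 0 ≤ t * M := mul_nonneg ht.1 hM'.le
  have hle : ⌊t * M⌋₊ ≤ M := Nat.floor_le_of_le (by nlinarith [ht.2])
  have hval : (level M t : ℕ) = ⌊t * M⌋₊ := Nat.mod_eq_of_lt (by omega)
  rw [hval, sub_div' hM'.ne', abs_div, abs_of_pos hM']
  refine div_le_div_of_nonneg_right (abs_le.2 ⟨?_, ?_⟩) hM'.le
  · linarith [Nat.floor_le h0]
  · linarith [Nat.lt_floor_add_one (t * M)]

/-- A graphon-signal whose kernel is close to a step function is close to a coded step
graphon-signal. -/
lemma exists_stepCode_cutDist_le {r : ℝ} (hr : 0 < r) {η : ℝ} {n M K : ℕ} (hM : 0 < M) [NeZero K]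
    (hK : ((n * (M + 1) : ℕ) : ℝ) / K ≤ 1 / M) (u : GraphonSignal r) {q : I → Fin n}
    (hq : Measurable q) {w : Fin n → Fin n → ℝ} (hws : ∀ i j, w i j = w j i)
    (hw01 : ∀ i j, w i j ∈ Icc (0 : ℝ) 1)
    (hcut : supInt volume rect (fun z : I × I => u.W z.1 z.2 - w (q z.1) (q z.2)) ≤ η) :
    ∃ d : StepCode n M K, cutDist u (stepGraphonSignal hr.le d) ≤ η + (3 + 4 * r) / M := by
  have hM' : (0 : ℝ) < M := by exact_mod_cast hM
  have ht : ∀ x, (u.f x + r) / (2 * r) ∈ Icc (0 : ℝ) 1 := fun x => by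
    have := abs_le.1 (u.abs_f_le x)
    exact ⟨div_nonneg (by linarith) (by linarith), div_le_one_of_le₀ (by linarith) (by linarith)⟩
  let b : I → Fin (M + 1) := fun x => level M ((u.f x + r) / (2 * r))
  have hb : Measurable b :=
    (measurable_level M).comp ((u.measurable_f.add_const r).div_const _)
  -- Kernel type and signal level are merged into one partition, so that a single rearrangement
  -- serves both.
  let e : Fin n × Fin (M + 1) ≃ Fin (n * (M + 1)) := finProdFinEquiv
  have hqb : Measurable fun x => e (q x, b x) := (measurable_of_finite e).comp (hq.prodMk hb)
  obtain ⟨φ, c, hc⟩ := exists_conullBijection_grid hqb K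
  let d : StepCode n M K := (fun k => e.symm (c k), fun i j => level M (w i j))
  set B : Set I := {x | e (q x, b x) ≠ c (gridIndex K (φ.toFun x))} with hB
  have hBm : MeasurableSet B := by
    have : Measurable fun x => c (gridIndex K (φ.toFun x)) :=
      (measurable_of_finite c).comp ((measurable_gridIndex K).comp φ.measurable_toFun)
    exact (measurableSet_eq_fun hqb this).compl
  have hBv : volume.real B ≤ 1 / M := hc.trans hK
  have hgood : ∀ x, x ∉ B → d.1 (gridIndex K (φ.toFun x)) = (q x, b x) := fun x hx => by
    have : e (q x, b x) = c (gridIndex K (φ.toFun x)) := not_not.1 hx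
    simp [d, ← this]
  obtain ⟨v, hvd⟩ : ∃ v, v = stepGraphonSignal hr.le d := ⟨_, rfl⟩
  let iB : I → ℝ := B.indicator fun _ => 1
  have hiB : Integrable iB := (integrable_const (1 : ℝ)).indicator hBm
  have hiBv : ∫ x, iB x = volume.real B := integral_indicator_one hBm
  have hiB0 : ∀ x, 0 ≤ iB x := fun x => indicator_nonneg (fun _ _ => zero_le_one) x
  refine ⟨d, hvd ▸ (cutDist_le u v φ).trans ?_⟩
  rw [cutMetric, kernel_eq, signal_eq]
  have hstep : BM fun z : I × I => w (q z.1) (q z.2) :=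
    BM.comp_fintype (measurable_pairIndex hq) fun k => w k.1 k.2
  have hvW : BM fun z : I × I => v.W (φ.toFun z.1) (φ.toFun z.2) :=
    v.bmW.comp φ.prodMP.measurable
  have hi1 : Integrable fun z : I × I => iB z.1 := hiB.comp_fst volume
  have hi2 : Integrable fun z : I × I => iB z.2 := hiB.comp_snd volume
  -- One `1 / M` is rounding; the other two bound the strips where a coordinate lies in the
  -- exceptional set `B`.
  have hkernel : supInt volume rect
      (fun z : I × I => w (q z.1) (q z.2) - v.W (φ.toFun z.1) (φ.toFun z.2)) ≤ 3 / M := by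
    have hi0 : Integrable fun _ : I × I => (1 / M : ℝ) := integrable_const _
    have hi01 : Integrable fun z : I × I => 1 / M + iB z.1 := hi0.add hi1
    refine (supInt_le_integral (G := fun z => 1 / M + iB z.1 + iB z.2) rect
      (hi01.add hi2) fun z => ?_).trans ?_
    · by_cases h1 : z.1 ∈ B
      · have e1 : iB z.1 = 1 := indicator_of_mem h1 _
        have h3 := hw01 (q z.1) (q z.2)
        have h4 := v.W_mem (φ.toFun z.1) (φ.toFun z.2)
        have h5 : (0 : ℝ) ≤ 1 / M := by positivity
        rw [e1]
        exact abs_le.2 ⟨by linarith [h3.1, h4.2, hiB0 z.2], by linarith [h3.2, h4.1, hiB0 z.2]⟩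
      by_cases h2 : z.2 ∈ B
      · have e1 : iB z.2 = 1 := indicator_of_mem h2 _
        have h3 := hw01 (q z.1) (q z.2)
        have h4 := v.W_mem (φ.toFun z.1) (φ.toFun z.2)
        have h5 : (0 : ℝ) ≤ 1 / M := by positivity
        rw [e1]
        exact abs_le.2 ⟨by linarith [h3.1, h4.2, hiB0 z.1], by linarith [h3.2, h4.1, hiB0 z.1]⟩
      · have hv : v.W (φ.toFun z.1) (φ.toFun z.2) = (level M (w (q z.1) (q z.2)) : ℕ) / M := by
          simp only [hvd, stepGraphonSignal, stepKernel, hgood _ h1, hgood _ h2]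
          simp only [d, hws (q z.2) (q z.1)]
          field_simp
          ring
        rw [hv]
        linarith [abs_sub_level_le hM (hw01 (q z.1) (q z.2)), hiB0 z.1, hiB0 z.2]
    · rw [integral_add hi01 hi2, integral_add hi0 hi1]
      have e1 : ∫ z : I × I, iB z.1 = volume.real B := by
        rw [← hiBv, Measure.volume_eq_prod, integral_fun_fst]
        simp
      have e2 : ∫ z : I × I, iB z.2 = volume.real B := by
        rw [← hiBv, Measure.volume_eq_prod, integral_fun_snd]
        simp
      rw [e1, e2]
      have : (3 : ℝ) / M = 1 / M + 1 / M + 1 / M := by ring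
      simp only [integral_const, probReal_univ, one_smul]
      linarith
  have hkernel' : supInt volume rect
      (fun z : I × I => u.W z.1 z.2 - v.W (φ.toFun z.1) (φ.toFun z.2)) ≤ η + 3 / M :=
    (supInt_add_le volume rect (u.bmW.sub hstep) (hstep.sub hvW) (fun z => by ring)).trans
      (add_le_add hcut hkernel)
  -- Rounding costs `2 * r / M`, and on `B`, of measure at most `1 / M`, the signals differ by at
  -- most `2 * r`.
  have hsignal : supInt volume (fun S : {S : Set I // MeasurableSet S} => (S : Set I))
      (fun x => u.f x - v.f (φ.toFun x)) ≤ 4 * r / M := by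
    have hi0 : Integrable fun _ : I => (2 * r / M : ℝ) := integrable_const _
    have hi1 : Integrable fun x : I => 2 * r * iB x := hiB.const_mul _
    refine (supInt_le_integral (G := fun x => 2 * r / M + 2 * r * iB x) _
      (hi0.add hi1) fun x => ?_).trans ?_
    · by_cases h1 : x ∈ B
      · have e1 : iB x = 1 := indicator_of_mem h1 _
        have h3 := abs_le.1 (u.abs_f_le x)
        have h4 := abs_le.1 (v.abs_f_le (φ.toFun x))
        have h5 : (0 : ℝ) ≤ 2 * r / M := by positivity
        rw [e1]
        exact abs_le.2 ⟨by linarith, by linarith⟩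
      · have e1 : iB x = 0 := indicator_of_notMem h1 _
        have hv : u.f x - v.f (φ.toFun x) =
            2 * r * ((u.f x + r) / (2 * r) - (b x : ℕ) / M) := by
          simp only [hvd, stepGraphonSignal, stepSignal, hgood _ h1]
          field_simp
          ring
        rw [hv, e1, abs_mul, abs_of_pos (by positivity : 0 < 2 * r), mul_zero, add_zero,
          ← mul_one_div (2 * r)]
        exact mul_le_mul_of_nonneg_left (abs_sub_level_le hM (ht x)) (by positivity)
    · rw [integral_add hi0 hi1, integral_const_mul, hiBv]
      simp only [integral_const, probReal_univ, one_smul]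
      have : 2 * r * volume.real B ≤ 2 * r * (1 / M) :=
        mul_le_mul_of_nonneg_left hBv (by positivity)
      have h2 : 4 * r / M = 2 * r / M + 2 * r * (1 / M) := by ring
      linarith
  have : (3 + 4 * r) / M = 3 / M + 4 * r / M := by ring
  rw [this, ← add_assoc]
  exact add_le_add hkernel' hsignal

/-- Count bits: since `M + 1 ≤ 2 ^ M`, each of the `K` cells needs at most `2 * m + M`, and each of
the `16 ^ m` pairs of types at most `M`. -/
lemma card_stepCode_le (n m M K : ℕ) (hn : n = 4 ^ m) :
    Fintype.card (StepCode n M K) ≤ 2 ^ ((2 * m + M) * K + M * 16 ^ m) := by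
  have hM : M + 1 ≤ 2 ^ M := Nat.lt_two_pow_self
  have h4 : 4 ^ m = 2 ^ (2 * m) := by rw [pow_mul]; norm_num
  have h16 : 4 ^ m * 4 ^ m = 16 ^ m := by rw [← mul_pow]; norm_num
  simp only [StepCode, Fintype.card_prod, Fintype.card_fun, Fintype.card_fin]
  rw [← pow_mul, hn, h16, pow_add, pow_mul, pow_mul]
  refine Nat.mul_le_mul (Nat.pow_le_pow_left ?_ _) (Nat.pow_le_pow_left hM _)
  rw [h4, pow_add]
  exact Nat.mul_le_mul le_rfl hM

/-- The code length is at most a cubic polynomial in `m` times `16 ^ m`, and `16 < 4 ^ a` because `2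
< a`. The shift `m - 1` reflects that `m` will be `⌊1 / ε ^ 2⌋₊ + 1`. -/
lemma eventually_code_length_le {a : ℝ} (ha : 2 < a) (c : ℕ) :
    ∃ m₀ : ℕ, ∀ m ≥ m₀, (((2 * m + c * m) * (4 ^ m * (c * m + 1) * (c * m)) + c * m * 16 ^ m : ℕ) : ℝ) ≤
      (4 : ℝ) ^ (a * (m - 1)) := by
  set Q : ℝ := (2 + c) * (c + 1) * c + c with hQ
  have hQ0 : 0 ≤ Q := by positivity
  have h4a : (0 : ℝ) < 4 ^ a := by positivity
  have hρ : |16 / (4 : ℝ) ^ a| < 1 := by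
    rw [abs_of_pos (by positivity), div_lt_one h4a]
    calc (16 : ℝ) = 4 ^ (2 : ℝ) := by norm_num
      _ < 4 ^ a := Real.rpow_lt_rpow_of_exponent_lt (by norm_num) ha
  have hlim := (tendsto_pow_const_mul_const_pow_of_abs_lt_one 3 hρ).const_mul (Q * 4 ^ a)
  rw [mul_zero] at hlim
  obtain ⟨m₀, hm₀⟩ := Filter.eventually_atTop.1 (hlim.eventually (gt_mem_nhds one_pos))
  refine ⟨max m₀ 1, fun m hm => ?_⟩
  have h := hm₀ m ((le_max_left _ _).trans hm)
  have hm1 : (1 : ℝ) ≤ m := by exact_mod_cast (le_max_right _ _).trans hm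
  have h44 : (4 : ℝ) ^ m ≤ 16 ^ m := pow_le_pow_left₀ (by norm_num) (by norm_num) m
  have hrpow : (4 : ℝ) ^ (a * (m - 1)) = (4 ^ a) ^ m / 4 ^ a := by
    rw [mul_sub, mul_one, Real.rpow_sub (by norm_num), Real.rpow_mul (by norm_num),
      Real.rpow_natCast]
  have hpoly : (((2 * m + c * m) * (4 ^ m * (c * m + 1) * (c * m)) + c * m * 16 ^ m : ℕ) : ℝ) ≤
      Q * m ^ 3 * 16 ^ m := by
    push_cast
    have hc0 : (0 : ℝ) ≤ c := c.cast_nonneg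
    have e1 : (2 * (m : ℝ) + c * m) * (4 ^ m * (c * m + 1) * (c * m)) ≤
        (2 * (m : ℝ) + c * m) * (16 ^ m * (c * m + m) * (c * m)) := by
      gcongr
    have e2 : (c : ℝ) * m * 16 ^ m ≤ c * m ^ 3 * 16 ^ m := by
      gcongr
      exact le_self_pow₀ hm1 (by norm_num)
    refine (add_le_add e1 e2).trans (le_of_eq ?_)
    rw [hQ]
    ring
  refine hpoly.trans ?_
  rw [hrpow, le_div_iff₀ h4a]
  rw [div_pow] at h
  have hpos : (0 : ℝ) < (4 ^ a) ^ m := by positivity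
  have h' : Q * 4 ^ a * (m ^ 3 * (16 ^ m / (4 ^ a) ^ m)) = (Q * m ^ 3 * 16 ^ m * 4 ^ a) / (4 ^ a) ^ m := by
    ring
  rw [h', div_lt_one hpos] at h
  exact h.le

lemma four_rpow_le_ceil_sq (a ε : ℝ) :
    (4 : ℝ) ^ (a / ε ^ 2) ≤ ((⌈(2 : ℝ) ^ (a / ε ^ 2)⌉₊ ^ 2 : ℕ) : ℝ) := by
  have h := Nat.le_ceil ((2 : ℝ) ^ (a / ε ^ 2))
  have : (4 : ℝ) ^ (a / ε ^ 2) = ((2 : ℝ) ^ (a / ε ^ 2)) ^ 2 := by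
    rw [sq (_ ^ _), ← Real.mul_rpow (by norm_num) (by norm_num)]
    norm_num
  rw [this]
  push_cast
  exact pow_le_pow_left₀ (by positivity) h 2

/-- The graphon-signal space has covering numbers at most `coverFormula a ε` for small `ε`. -/
lemma exists_cover {r : ℝ} (hr : 0 < r) {a : ℝ} (ha : 2 < a) :
    ∃ ε₀ : ℝ, 0 < ε₀ ∧ ∀ ε : ℝ, 0 < ε → ε ≤ ε₀ →
      ∃ z : Fin (coverFormula a ε) → GraphonSignalSpace r, (⋃ i, Metric.ball (z i) ε) = univ := by
  -- With `M = c * m` and `ε * m > 1`, this choice makes the rounding error `(3 + 4 * r) / M` less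
  -- than `ε / 2`.
  obtain ⟨c, hc⟩ := exists_nat_gt (2 * (3 + 4 * r))
  obtain ⟨m₀, hm₀⟩ := eventually_code_length_le ha c
  refine ⟨1 / (m₀ + 1), by positivity, fun ε hε hε₀ => ?_⟩
  have hε1 : ε ≤ 1 := hε₀.trans (by rw [div_le_one (by positivity)]; linarith [m₀.cast_nonneg (α := ℝ)])
  have hinv : 1 / ε ≤ 1 / ε ^ 2 := by
    rw [div_le_div_iff₀ hε (by positivity)]
    nlinarith
  have hm₀ε : (m₀ : ℝ) + 1 ≤ 1 / ε := by
    rw [le_div_iff₀ hε]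
    rwa [le_div_iff₀ (by positivity), mul_comm] at hε₀
  -- The other half of `ε` is the regularity error: `1 / 4 < m * (ε / 2) ^ 2` means `1 / ε ^ 2 < m`.
  set m := ⌊1 / ε ^ 2⌋₊ + 1 with hm
  have hmlt : 1 / ε ^ 2 < m := by
    rw [hm]; push_cast; exact Nat.lt_floor_add_one _
  have hmle : (m : ℝ) - 1 ≤ 1 / ε ^ 2 := by
    rw [hm]; push_cast; linarith [Nat.floor_le (show 0 ≤ 1 / ε ^ 2 by positivity)]
  have hmm₀ : m₀ ≤ m := by
    have : (m₀ : ℝ) ≤ m := by linarith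
    exact_mod_cast this
  have hc0 : 0 < c := by
    have : (0 : ℝ) < c := lt_trans (by positivity) hc
    exact_mod_cast this
  have hM : 0 < c * m := Nat.mul_pos hc0 (by omega)
  -- The number of grid cells is `n * (M + 1) * M`, so the exceptional set has measure at most `1 /
  -- M`.
  have : NeZero (4 ^ m * (c * m + 1) * (c * m)) := ⟨by positivity⟩
  have hcard : Fintype.card (StepCode (4 ^ m) (c * m) (4 ^ m * (c * m + 1) * (c * m))) ≤
      coverFormula a ε := by
    refine (card_stepCode_le _ m _ _ rfl).trans (Nat.pow_le_pow_right (by norm_num) ?_)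
    have h := (hm₀ m hmm₀).trans ((Real.rpow_le_rpow_of_exponent_le (by norm_num)
      (show a * (m - 1) ≤ a / ε ^ 2 by
        rw [← mul_one_div]
        exact mul_le_mul_of_nonneg_left hmle (by linarith))).trans (four_rpow_le_ceil_sq a ε))
    exact_mod_cast h
  obtain ⟨g⟩ : Nonempty (StepCode (4 ^ m) (c * m) (4 ^ m * (c * m + 1) * (c * m)) ↪
      Fin (coverFormula a ε)) :=
    Function.Embedding.nonempty_of_card_le (by simpa using hcard)
  have : NeZero (4 ^ m) := ⟨by positivity⟩
  refine ⟨fun i => SeparationQuotient.mk (stepGraphonSignal hr.le (Function.invFun g i)),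
    eq_univ_of_forall fun x => ?_⟩
  obtain ⟨u, rfl⟩ := SeparationQuotient.surjective_mk x
  obtain ⟨q, hq, w, hws, hw01, hcut⟩ := u.exists_step_cutNorm_le (half_pos hε) (m := m)
    (by rw [div_lt_iff₀ (by positivity)] at hmlt; nlinarith)
  obtain ⟨d, hd⟩ := exists_stepCode_cutDist_le (K := 4 ^ m * (c * m + 1) * (c * m)) hr hM
    (by
      have : ((c * m : ℕ) : ℝ) ≠ 0 := by positivity
      rw [Nat.cast_mul (4 ^ m * (c * m + 1))]
      field_simp
      rfl) u hq hws hw01 hcut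
  refine mem_iUnion.2 ⟨g d, ?_⟩
  change dist _ (SeparationQuotient.mk (stepGraphonSignal hr.le (Function.invFun g (g d)))) < ε
  rw [Function.leftInverse_invFun g.injective d, SeparationQuotient.dist_mk]
  refine lt_of_le_of_lt hd ?_
  have hlt : (3 + 4 * r) / ((c * m : ℕ) : ℝ) < ε / 2 := by
    have h1 : 1 < ε * m := by
      have : 1 / ε < m := lt_of_le_of_lt hinv hmlt
      rwa [div_lt_iff₀ hε, mul_comm] at this
    push_cast
    rw [div_lt_iff₀ (by positivity)]
    nlinarith
  linarith

end Cover

/-! ### The inverse of `ξ` and the numerical constants. -/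

section Rate

/-- The growth is doubly exponential, so crude bounds suffice: with `x = 1 / e ^ 2 ≥ 64` one has `k
≥ x` and `2 ^ k ^ 2 ≥ k ^ 2 ≥ 64 * x`. This yields `√κ ≥ 8 / e` in `error_le_rate`. -/
lemma coverFormula_ge {a : ℝ} (ha : 2 < a) {e : ℝ} (he : 0 < e) (he8 : e ≤ 1 / 8) :
    64 / e ^ 2 ≤ (coverFormula a e : ℝ) := by
  have hx : 64 ≤ 1 / e ^ 2 := by
    rw [le_div_iff₀ (by positivity)]
    nlinarith
  set x := 1 / e ^ 2
  have hpow : x ≤ (2 : ℝ) ^ (a / e ^ 2) := by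
    have h1 : x + 1 ≤ Real.exp x := Real.add_one_le_exp x
    have h2 : Real.exp x ≤ (2 : ℝ) ^ (a / e ^ 2) := by
      rw [Real.rpow_def_of_pos (by norm_num), Real.exp_le_exp, ← mul_one_div a]
      have hl : (1 : ℝ) ≤ Real.log 2 * a := by nlinarith [Real.log_two_gt_d9]
      calc x = 1 * x := (one_mul x).symm
        _ ≤ Real.log 2 * a * x := mul_le_mul_of_nonneg_right hl (by linarith)
        _ = Real.log 2 * (a * x) := mul_assoc _ _ _
    linarith
  set k := ⌈(2 : ℝ) ^ (a / e ^ 2)⌉₊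
  have hk : x ≤ k := hpow.trans (Nat.le_ceil _)
  have h2 : ((k ^ 2 : ℕ) : ℝ) ≤ (coverFormula a e : ℝ) := by
    exact_mod_cast (Nat.lt_two_pow_self (n := k ^ 2)).le
  refine le_trans ?_ h2
  push_cast
  rw [show 64 / e ^ 2 = 64 * x by simp only [x]; ring]
  nlinarith

lemma one_le_log_of_three_le {κ : ℝ} (hκ : 3 ≤ κ) : 1 ≤ Real.log κ := by
  rw [Real.le_log_iff_exp_le (by linarith)]
  linarith [Real.exp_one_lt_d9]

/-- The generalized inverse of `ξ` is positive, and is approximated from above by points where `ξ`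
is small. -/
lemma exists_near_xiInv {a : ℝ} (ha : 2 < a) {ε₁ : ℝ} (h₁ : 0 < ε₁) (h₁8 : ε₁ ≤ 1 / 8) {y : ℝ}
    (hy : 0 < y) :
    ∃ ε : ℝ, 0 < ε ∧ xi a ε₁ ε ≤ y ∧ 0 < xiInv a ε₁ y ∧ ε ≤ 11 / 10 * xiInv a ε₁ y := by
  set S := {ε : ℝ | 0 < ε ∧ xi a ε₁ ε ≤ y} with hS
  have hpos : 0 < sInf S := by
    have hne : S.Nonempty := by
      set Q : ℝ := (coverFormula a ε₁ : ℝ) ^ 2 * Real.log (coverFormula a ε₁)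
      -- Beyond `ε₁` the covering function is frozen and `ξ` decays like `Q / ε ^ 2`.
      refine ⟨max ε₁ (max 1 (Q / y)), lt_max_of_lt_left h₁, ?_⟩
      have h1 : 1 ≤ max ε₁ (max 1 (Q / y)) := le_max_of_le_right (le_max_left _ _)
      have h2 : Q / y ≤ max ε₁ (max 1 (Q / y)) := le_max_of_le_right (le_max_right _ _)
      rw [xi, kappa, min_eq_right (le_max_left _ _), div_le_iff₀ (by positivity)]
      rw [div_le_iff₀ hy] at h2
      exact h2.trans (by nlinarith [mul_le_mul_of_nonneg_left h1 (mul_pos hy (one_pos.trans_le h1)).le])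
    -- Because `κ ^ 2 * log κ ≥ 1`, the condition `ξ(ε) ≤ y` forces `1 ≤ y * ε ^ 2`.
    refine lt_of_lt_of_le (b := 1 / √y) (by positivity) (le_csInf hne fun ε hε => ?_)
    have hε0 := hε.1
    have he : 0 < min ε ε₁ := lt_min hε0 h₁
    have he8 : min ε ε₁ ≤ 1 / 8 := (min_le_right _ _).trans h₁8
    have hκ : 3 ≤ (kappa a ε₁ ε : ℝ) := by
      refine le_trans ?_ (coverFormula_ge ha he he8)
      rw [le_div_iff₀ (by positivity)]
      nlinarith
    have hlog := one_le_log_of_three_le hκ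
    have h := hε.2
    rw [xi, div_le_iff₀ (by positivity)] at h
    have h1 : 1 ≤ y * ε ^ 2 := by nlinarith
    rw [div_le_iff₀ (by positivity), ← abs_of_pos (show 0 < ε * √y by positivity),
      ← one_le_sq_iff_one_le_abs, mul_pow, Real.sq_sqrt hy.le]
    linarith
  have hne : S.Nonempty := by
    by_contra h
    rw [not_nonempty_iff_eq_empty.1 h, Real.sInf_empty] at hpos
    exact lt_irrefl _ hpos
  -- A factor above 1 avoids deciding whether the infimum is attained; `error_le_rate` has room for
  -- it.
  obtain ⟨ε, hε, hlt⟩ := exists_lt_of_csInf_lt hne (show sInf S < 11 / 10 * sInf S by linarith)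
  exact ⟨ε, hε.1, hε.2, hpos, hlt.le⟩

/-- The deviation of the class frequencies, for samples of size at least `2 C ξ(ε)`. -/
lemma two_mul_sqrt_le {κ C N ε p : ℝ} (hκ : 3 ≤ κ) (hC : 1 ≤ C) (hN : 0 < N) (hε : 0 < ε)
    (hp : 0 < p) (hp1 : p < 1) (hξ : κ ^ 2 * Real.log κ / ε ^ 2 ≤ N / (2 * C)) :
    2 * √((κ * C * Real.log 2 + Real.log (1 / p)) / (2 * N)) ≤
      ε * (1 + √(Real.log (2 / p))) / √κ := by
  have hlogκ := one_le_log_of_three_le hκ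
  have hlp : 0 ≤ Real.log (1 / p) := Real.log_nonneg (by rw [le_div_iff₀ hp]; linarith)
  have hl2 : 0 ≤ Real.log (2 / p) := Real.log_nonneg (by rw [le_div_iff₀ hp]; linarith)
  have hle : Real.log (1 / p) ≤ Real.log (2 / p) :=
    Real.log_le_log (by positivity) (by gcongr; norm_num)
  have hlog2 : Real.log 2 ≤ 1 := by linarith [Real.log_two_lt_d9]
  have hlog20 : 0 ≤ Real.log 2 := by positivity
  set s := √(Real.log (2 / p)) with hs
  have hs0 : 0 ≤ s := Real.sqrt_nonneg _
  have hs2 : Real.log (2 / p) = s ^ 2 := (Real.sq_sqrt hl2).symm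
  rw [div_le_div_iff₀ (by positivity) (by positivity)] at hξ
  rw [le_div_iff₀ (by positivity)]
  refine abs_le_of_sq_le_sq' ?_ (by positivity) |>.2
  rw [mul_pow, mul_pow, Real.sq_sqrt (by positivity), Real.sq_sqrt (by linarith)]
  -- The `C` from the number of cells cancels the one in `N / (2 * C)`, and only one of the two
  -- factors `κ` is spent, which leaves the gain `1 / √κ`.
  have h1 : κ * C * Real.log 2 + Real.log (1 / p) ≤ κ * C * (1 + s) ^ 2 := by
    have e1 : κ * C * Real.log 2 ≤ κ * C * 1 := mul_le_mul_of_nonneg_left hlog2 (by positivity)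
    have e2 : s ^ 2 ≤ κ * C * s ^ 2 := le_mul_of_one_le_left (sq_nonneg _) (by nlinarith)
    have e3 : 0 ≤ κ * C * (2 * s) := by positivity
    nlinarith
  have h2 : 2 * (κ ^ 2 * C) ≤ N * ε ^ 2 := by
    have : κ ^ 2 * 1 ≤ κ ^ 2 * Real.log κ := mul_le_mul_of_nonneg_left hlogκ (sq_nonneg _)
    nlinarith
  calc 2 ^ 2 * ((κ * C * Real.log 2 + Real.log (1 / p)) / (2 * N)) * κ
      ≤ 2 ^ 2 * ((κ * C * (1 + s) ^ 2) / (2 * N)) * κ := by gcongr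
    _ = (2 * (κ ^ 2 * C)) / N * (1 + s) ^ 2 := by field_simp
    _ ≤ (N * ε ^ 2) / N * (1 + s) ^ 2 := by gcongr
    _ = (ε * (1 + s)) ^ 2 := by field_simp

/-- The oscillation factor involves `L₂` alone and the diameter, whereas the target involves only
`L₁ * L₂`. The gain `1 / √κ ≤ e / 8` repairs both. The loss of `11 / 10` is then covered by `1 / √2
≥ 7 / 10`. -/
lemma error_le_rate {r L₁ L₂ e ε ε' κ t s E : ℝ} (hr : 0 ≤ r) (hL₁ : 0 < L₁) (hL₂ : 0 ≤ L₂)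
    (he : 0 < e) (heε : e ≤ ε) (heL : e ≤ L₁) (her : (1 + 2 * r) * e ≤ 1) (hκ : 64 / e ^ 2 ≤ κ)
    (ht : 2 * t ≤ ε * (1 + s) / √κ) (hs : 0 ≤ s) (hε' : 0 < ε') (hεε' : ε ≤ 11 / 10 * ε')
    (hE : 0 ≤ E) :
    2 * (L₁ * L₂) * e + 2 * (L₂ * (1 + L₁ * (1 + 2 * r))) * t ≤
      ε' * (2 * (L₁ * L₂) + 1 / √2 * (L₁ * L₂ + E) * (1 + s)) := by
  have hε : 0 < ε := he.trans_le heε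
  set L : ℝ := L₁ * L₂ with hL
  have hL0 : 0 ≤ L := by positivity
  have hsqrt : 8 / e ≤ √κ := by
    refine Real.le_sqrt_of_sq_le ?_
    rw [div_pow]
    norm_num
    exact hκ
  have hκ0 : 0 < √κ := lt_of_lt_of_le (by positivity) hsqrt
  have ht' : 2 * t ≤ ε * (1 + s) * (e / 8) := by
    refine ht.trans ?_
    rw [div_le_iff₀ hκ0, mul_assoc (ε * (1 + s))]
    refine le_mul_of_one_le_right (by positivity) ?_
    calc (1 : ℝ) = e / 8 * (8 / e) := by field_simp
      _ ≤ e / 8 * √κ := by gcongr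
  -- Here `e ≤ L₁` turns `L₂ * e` into at most `L`, which is why the scale is cut off at a multiple
  -- of `min 1 L₁`; `(1 + 2 * r) * e ≤ 1` handles the diameter.
  have hosc : L₂ * (1 + L₁ * (1 + 2 * r)) * e ≤ 2 * L := by
    have h3 : (1 + L₁ * (1 + 2 * r)) * e ≤ 2 * L₁ := by nlinarith
    calc L₂ * (1 + L₁ * (1 + 2 * r)) * e = L₂ * ((1 + L₁ * (1 + 2 * r)) * e) := by ring
      _ ≤ L₂ * (2 * L₁) := mul_le_mul_of_nonneg_left h3 hL₂
      _ = 2 * L := by rw [hL]; ring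
  have hsecond : 2 * (L₂ * (1 + L₁ * (1 + 2 * r))) * t ≤ ε * (1 + s) * L / 4 := by
    have hnn : 0 ≤ L₂ * (1 + L₁ * (1 + 2 * r)) := by positivity
    calc 2 * (L₂ * (1 + L₁ * (1 + 2 * r))) * t = L₂ * (1 + L₁ * (1 + 2 * r)) * (2 * t) := by ring
      _ ≤ L₂ * (1 + L₁ * (1 + 2 * r)) * (ε * (1 + s) * (e / 8)) :=
          mul_le_mul_of_nonneg_left ht' hnn
      _ = ε * (1 + s) / 8 * (L₂ * (1 + L₁ * (1 + 2 * r)) * e) := by ring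
      _ ≤ ε * (1 + s) / 8 * (2 * L) := mul_le_mul_of_nonneg_left hosc (by positivity)
      _ = ε * (1 + s) * L / 4 := by ring
  have hroot : (7 : ℝ) / 10 ≤ 1 / √2 := by
    rw [le_div_iff₀ (by positivity)]
    have : √2 ≤ 10 / 7 := Real.sqrt_le_iff.2 ⟨by norm_num, by norm_num⟩
    linarith
  have hfirst : 2 * L * e ≤ 2 * L * ε := mul_le_mul_of_nonneg_left heε (by positivity)
  have hfin : 7 / 10 * L * (1 + s) ≤ 1 / √2 * (L + E) * (1 + s) := by
    gcongr
    exact le_add_of_nonneg_right hE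
  have hslack : 11 / 10 * (2 * L + (1 + s) * L / 4) ≤ 2 * L + 7 / 10 * L * (1 + s) := by
    nlinarith [mul_nonneg hL0 hs]
  calc 2 * L * e + 2 * (L₂ * (1 + L₁ * (1 + 2 * r))) * t
      ≤ ε * (2 * L + (1 + s) * L / 4) := by linarith
    _ ≤ 11 / 10 * ε' * (2 * L + (1 + s) * L / 4) := by gcongr
    _ = ε' * (11 / 10 * (2 * L + (1 + s) * L / 4)) := by ring
    _ ≤ ε' * (2 * L + 1 / √2 * (L + E) * (1 + s)) :=
        mul_le_mul_of_nonneg_left (by linarith) hε'.le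

end Rate

/-! ### Assembly of the generalization theorem. -/

lemma IsClassifier.exists_measurable_class {r : ℝ} {C : ℕ} {cl : GraphonSignalSpace r → Fin C → ℝ}
    (h : IsClassifier cl) :
    ∃ cls : GraphonSignalSpace r → Fin C, Measurable cls ∧ ∀ x, cl x = Pi.single (cls x) 1 := by
  obtain ⟨B, hBm, hBd, hBu, hB⟩ := h
  have hex : ∀ x, ∃ i, x ∈ B i := fun x => by
    have : x ∈ ⋃ i, B i := hBu ▸ mem_univ x
    simpa using this
  choose cls hcls using hex
  refine ⟨cls, measurable_to_countable' fun i => ?_, fun x => hB _ x (hcls x)⟩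
  have : cls ⁻¹' {i} = B i := by
    ext x
    refine ⟨fun hx => ?_, fun hx => ?_⟩
    · rw [← show cls x = i from hx]
      exact hcls x
    · by_contra hne
      exact (hBd _ _ hne).le_bot ⟨hcls x, hx⟩
  rw [this]
  exact hBm i

/-- The generalization bound at the rate `ξ⁻¹`, from the cover at a single scale. -/
lemma exists_event_rate {r : ℝ} (hr : 0 < r) {a : ℝ} (ha : 2 < a) {ε₀ : ℝ} (h₀ : 0 < ε₀)
    (h₀8 : ε₀ ≤ 1 / 8) (h₀r : ε₀ * (1 + 2 * r) ≤ 1)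
    (hcover : ∀ ε : ℝ, 0 < ε → ε ≤ ε₀ →
      ∃ z : Fin (coverFormula a ε) → GraphonSignalSpace r, (⋃ i, Metric.ball (z i) ε) = univ)
    {C N : ℕ} (hC : 1 ≤ C) (hN : 1 ≤ N) (ν : Measure (GraphonSignalSpace r))
    [IsProbabilityMeasure ν] {cls : GraphonSignalSpace r → Fin C} (hcls : Measurable cls)
    {L₁ : ℝ≥0} (L₂ : ℝ≥0) (hL₁ : 0 < L₁) {p : ℝ} (hp : 0 < p) (hp1 : p < 1) :
    ∃ U : Set (Fin N → GraphonSignalSpace r),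
      MeasurableSet U ∧ 1 - p ≤ (Measure.pi fun _ : Fin N => ν).real U ∧
      ∀ X ∈ U, ∀ loss : (Fin C → ℝ) × (Fin C → ℝ) → ℝ, LipschitzWith L₂ loss →
      ∀ Υ : GraphonSignalSpace r → Fin C → ℝ, LipschitzWith L₁ Υ →
        |∫ x, loss (Υ x, Pi.single (cls x) 1) ∂ν -
          1 / (N : ℝ) * ∑ i, loss (Υ (X i), Pi.single (cls (X i)) 1)| ≤
          xiInv a (ε₀ * min 1 (L₁ : ℝ)) ((N : ℝ) / (2 * C)) *
            (2 * ((L₁ : ℝ) * L₂) +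
              1 / √2 * ((L₁ : ℝ) * L₂ + |loss (0, 0)|) * (1 + √(Real.log (2 / p)))) := by
  have hL₁' : (0 : ℝ) < L₁ := hL₁
  have hC' : (1 : ℝ) ≤ C := by exact_mod_cast hC
  have hN' : (0 : ℝ) < N := by exact_mod_cast hN
  set ε₁ := ε₀ * min 1 (L₁ : ℝ)
  have h₁ : 0 < ε₁ := mul_pos h₀ (lt_min one_pos hL₁')
  have h₁₀ : ε₁ ≤ ε₀ := mul_le_of_le_one_right h₀.le (min_le_left _ _)
  have h₁L : ε₁ ≤ L₁ := by
    have : ε₁ ≤ ε₀ * L₁ := mul_le_mul_of_nonneg_left (min_le_right _ _) h₀.le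
    nlinarith
  obtain ⟨ε, hε, hξ, hstar, hεle⟩ :=
    exists_near_xiInv ha h₁ (h₁₀.trans h₀8) (show (0 : ℝ) < N / (2 * C) by positivity)
  set e := min ε ε₁ with he
  have he0 : 0 < e := lt_min hε h₁
  have heε : e ≤ ε := min_le_left _ _
  have he₁ : e ≤ ε₁ := min_le_right _ _
  -- The bound `hξ` fits because `kappa a ε₁ ε` is by definition `coverFormula a e`.
  obtain ⟨κ, hκ, hξκ, z, hz⟩ : ∃ κ : ℕ, 64 / e ^ 2 ≤ (κ : ℝ) ∧
      (κ : ℝ) ^ 2 * Real.log κ / ε ^ 2 ≤ N / (2 * C) ∧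
      ∃ z : Fin κ → GraphonSignalSpace r, (⋃ i, Metric.ball (z i) e) = univ :=
    ⟨coverFormula a e, coverFormula_ge ha he0 ((he₁.trans h₁₀).trans h₀8), hξ,
      hcover e he0 (he₁.trans h₁₀)⟩
  have hκ3 : (3 : ℝ) ≤ κ := by
    refine le_trans ?_ hκ
    rw [le_div_iff₀ (by positivity)]
    nlinarith
  -- This `t` makes the union bound `2 ^ (κ * C) * exp (-(2 * N * t ^ 2))` equal to `p`.
  set t := √((κ * C * Real.log 2 + Real.log (1 / p)) / (2 * N)) with ht
  have hlp : 0 ≤ Real.log (1 / p) := Real.log_nonneg (by rw [le_div_iff₀ hp]; linarith)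
  have ht2 : 2 * N * t ^ 2 = κ * C * Real.log 2 + Real.log (1 / p) := by
    rw [ht, Real.sq_sqrt (by positivity)]
    field_simp
  have hprob : 2 ^ (κ * C) * Real.exp (-(2 * N * t ^ 2)) ≤ p := by
    have h2 : (2 : ℝ) ^ (κ * C) = Real.exp (κ * C * Real.log 2) := by
      rw [← Nat.cast_mul, mul_comm _ (Real.log 2), ← Real.rpow_def_of_pos (by norm_num),
        Real.rpow_natCast]
    rw [ht2, h2, ← Real.exp_add, one_div, Real.log_inv]
    ring_nf
    rw [Real.exp_log hp]
  have hD : ∀ x y : GraphonSignalSpace r, dist x y ≤ 1 + 2 * r := by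
    intro x y
    obtain ⟨u, rfl⟩ := SeparationQuotient.surjective_mk x
    obtain ⟨v, rfl⟩ := SeparationQuotient.surjective_mk y
    rw [SeparationQuotient.dist_mk]
    exact cutDist_le_diam u v
  obtain ⟨U, hU, hUp, hUX⟩ := exists_event_generalization ν hN hz hcls hD (Real.sqrt_nonneg _)
    hprob L₁ L₂
  refine ⟨U, hU, hUp, fun X hX loss hloss Υ hΥ => (hUX X hX loss hloss Υ hΥ).trans ?_⟩
  have he₀ : e ≤ ε₀ := he₁.trans h₁₀
  exact error_le_rate hr.le hL₁' L₂.2 he0 heε (he₁.trans h₁L)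
    (by nlinarith) hκ (two_mul_sqrt_le hκ3 hC' hN' hε hp hp1 hξκ) (Real.sqrt_nonneg _)
    hstar hεle (abs_nonneg _)

end

end GraphonSignals

open GraphonSignals in
theorem mainTheorem5 (r : ℝ) (hr : 0 < r) (a : ℝ) (ha : 2 < a) :
    ∃ ε₀ : ℝ, 0 < ε₀ ∧
      (∀ ε : ℝ, 0 < ε → ε ≤ ε₀ →
        ∃ z : Fin (GraphonSignals.coverFormula a ε) → GraphonSignals.GraphonSignalSpace r,
          (⋃ i, Metric.ball (z i) ε) = Set.univ) ∧
      ∀ (C N : ℕ), 1 ≤ N →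
      ∀ (ν : MeasureTheory.Measure (GraphonSignals.GraphonSignalSpace r)),
        MeasureTheory.IsProbabilityMeasure ν →
      ∀ (cl : GraphonSignals.GraphonSignalSpace r → Fin C → ℝ), GraphonSignals.IsClassifier cl →
      ∀ (L₁ L₂ : NNReal), 0 < L₁ →
      ∀ p : ℝ, 0 < p →
      ∃ U : Set (Fin N → GraphonSignals.GraphonSignalSpace r),
        MeasurableSet U ∧
        1 - C * p - 2 * ((C : ℝ) ^ 2 / N) ≤ (MeasureTheory.Measure.pi fun _ : Fin N => ν).real U ∧
        ∀ X ∈ U, ∀ loss : (Fin C → ℝ) × (Fin C → ℝ) → ℝ, LipschitzWith L₂ loss →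
        ∀ Υ : GraphonSignals.GraphonSignalSpace r → Fin C → ℝ, LipschitzWith L₁ Υ →
          |GraphonSignals.statRisk ν loss cl Υ - GraphonSignals.empRisk loss cl Υ X| ≤
            GraphonSignals.xiInv a (ε₀ * min 1 (L₁ : ℝ)) ((N : ℝ) / (2 * C)) *
              (2 * ((L₁ : ℝ) * L₂) +
                1 / √2 * ((L₁ : ℝ) * L₂ + |loss (0, 0)|) * (1 + √(Real.log (2 / p)))) := by
  obtain ⟨η, hη, hcover⟩ := exists_cover hr ha
  have hr' : 0 < 1 / (1 + 2 * r) := by positivity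
  -- Besides the range of the cover, `1 / 8` serves `coverFormula_ge` and `1 / (1 + 2 * r)` serves
  -- the diameter condition of `error_le_rate`.
  refine ⟨min η (min (1 / 8) (1 / (1 + 2 * r))), lt_min hη (lt_min (by norm_num) hr'),
    fun ε hε hle => hcover ε hε (hle.trans (min_le_left _ _)), ?_⟩
  intro C N hN ν hν cl hcl L₁ L₂ hL₁ p hp
  obtain ⟨cls, hcls, hclseq⟩ := hcl.exists_measurable_class
  have hne : Nonempty (GraphonSignalSpace r) := MeasureTheory.nonempty_of_isProbabilityMeasure ν
  have hC : 1 ≤ C := Nat.one_le_iff_ne_zero.2 fun h => by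
    subst h
    exact (cls hne.some).elim0
  have hC' : (1 : ℝ) ≤ C := by exact_mod_cast hC
  have hCp : p ≤ C * p := le_mul_of_one_le_left hp.le hC'
  have hCN : (0 : ℝ) ≤ 2 * ((C : ℝ) ^ 2 / N) := by positivity
  -- For `p ≥ 1` the required probability is not positive, so the empty event will do.
  rcases lt_or_ge p 1 with hp1 | hp1
  · obtain ⟨U, hU, hUp, hUX⟩ := exists_event_rate hr ha
      (lt_min hη (lt_min (by norm_num) hr')) ((min_le_right _ _).trans (min_le_left _ _))
      ((le_div_iff₀ (by positivity)).1 ((min_le_right _ _).trans (min_le_right _ _)))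
      (fun ε hε hle => hcover ε hε (hle.trans (min_le_left _ _))) hC hN ν hcls L₂ hL₁ hp hp1
    refine ⟨U, hU, by linarith, fun X hX loss hloss Υ hΥ => ?_⟩
    simp only [statRisk, empRisk, hclseq]
    exact hUX X hX loss hloss Υ hΥ
  · exact ⟨∅, MeasurableSet.empty, by rw [MeasureTheory.measureReal_empty]; linarith,
      fun X hX => hX.elim⟩
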